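/- Notation. Let $d\ge 1$, let $\mathbb D^d=\{z\in\mathbb C^d: |z^i|<1,\ i=1,\dots,d\}$, and let $H^\infty_d$ be the algebra of bounded holomorphic functions on $\mathbb D^d$ with the norm $\|\varphi\|_\infty=\sup_{z\in\mathbb D^d}|\varphi(z)|$. A $d$-tuple $M=(M^1,\dots,M^d)$ of commuting $m\times m$ complex matrices has joint spectrum $\sigma(M)=\{\lambda\in\mathbb C^d:\ \exists x\neq 0,\ M^ix=\lambda^ix \text{ for all } i\}$. If $\sigma(M)\subset\mathbb D^d$ and $f$ is holomorphic on $\mathbb D^d$, then $$f(M)=\frac1{(2\pi i)^d}\int_{|\xi^1|=r}\cdots\int_{|\xi^d|=r} f(\xi)\,(\xi^1 I-M^1)^{-1}\cdots(\xi^d I-M^d)^{-1}\,d\xi^1\cdots d\xi^d,$$ where $r<1$ is larger than $|\lambda^i|$ for every $\lambda\in\sigma(M)$ and every $i$ (the value does not depend on $r$). An admissible kernel on $\mathbb D^d$ is the reproducing kernel $k$ of a Hilbert space $\mathcal H_k$ of holomorphic functions on $\mathbb D^d$, with continuous point evaluations, on which multiplication by each coordinate function $z^1,\dots,z^d$ is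 a contraction. Let $\mathcal A_d$ be the set of all admissible kernels on $\mathbb D^d$. For $k\in\mathcal A_d$ and $z\in\mathbb D^d$ let $k_z\in\mathcal H_k$ be the vector with $\langle f,k_z\rangle=f(z)$ for all $f\in\mathcal H_k$; for $M$ as above and $u,v\in\mathbb C^m$ let $K_M(u,v)\in\mathcal H_k$ be the vector with $\langle f,K_M(u,v)\rangle=\langle f(M)u,v\rangle_{\mathbb C^m}$ for all $f\in\mathcal H_k$. Let $A_1,\dots,A_N$ be $d$-tuples of commuting matrices, of possibly different sizes $s_1,\dots,s_N$, with joint spectra in $\mathbb D^d$, and let $\varphi_1,\dots,\varphi_N\in H^\infty_d$. For $k\in\mathcal A_d$ put $H_0=\operatorname{span}\{K_{A_j}(u,v): 1\le j\le N,\ u,v\in\mathbb C^{s_j}\}\subset\mathcal H_k$, and let $R^k\colon H_0\to H_0$ be the linear map with $$R^k\big(K_{A_j}(u,v)\big)=K_{A_j}\big(u,\varphi_j(A_j)^*v\big),\qquad 1\le j\le N,\ u,v\in\mathbb C^{s_j}.$$ For $z\in\mathbb D^d$ and $w\in\mathbb C$ let $\tilde R^k_w$ be the linear map on $H_1=\operatorname{span}(H_0\cup\{k_z\})$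 that extends $R^k$ and satisfies $\tilde R^k_w(k_z)=\overline w\,k_z$. Here $\|R^k\|$, respectively $\|\tilde R^k_w\|$, denotes the operator norm, understood to be $\infty$ if no linear map with the stated property exists. Theorem. (1) Let $d=2$. If $\sup_{k\in\mathcal A_2}\|R^k\|\le 1$, then there exists $\varphi\in H^\infty_2$ with $\|\varphi\|_\infty\le1$ and $\varphi(A_j)=\varphi_j(A_j)$ for $j=1,\dots,N$. (2) Let $d\ge1$ be arbitrary. For every $z\in\mathbb D^d$ there exists $w\in\mathbb C$, independent of $k$, such that $$\sup_{k\in\mathcal A_d}\|\tilde R^k_w\|=\sup_{k\in\mathcal A_d}\|R^k\|.$$ -/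

import Mathlib

open scoped ENNReal Matrix ComplexConjugate

noncomputable section

/-- The open unit polydisc of dimension `d`. -/
def polydisc (d : ℕ) : Set (Fin d → ℂ) := {z | ∀ i, ‖z i‖ < 1}

/-- The supremum norm of a function over the polydisc, with values in `[0, ∞]`. -/
def supNorm {d : ℕ} (φ : (Fin d → ℂ) → ℂ) : ℝ≥0∞ := ⨆ z ∈ polydisc d, ‖φ z‖ₑ

/-- `φ` restricts to a bounded holomorphic function on the polydisc. (The values of `φ` off the
polydisc are irrelevant.) -/
def MemHInfty {d : ℕ} (φ : (Fin d → ℂ) → ℂ) : Prop :=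
  DifferentiableOn ℂ φ (polydisc d) ∧ supNorm φ < ∞

/-- The joint spectrum of a `d`-tuple of `m × m` matrices: the set of its joint eigenvalues. -/
def jointSpectrum {d m : ℕ} (M : Fin d → Matrix (Fin m) (Fin m) ℂ) : Set (Fin d → ℂ) :=
  {lam | ∃ x : Fin m → ℂ, x ≠ 0 ∧ ∀ i, M i *ᵥ x = lam i • x}

/-- A `d`-tuple of commuting matrices with joint spectrum in the polydisc. -/
structure IsNode {d m : ℕ} (M : Fin d → Matrix (Fin m) (Fin m) ℂ) : Prop where
  commute : ∀ i j, Commute (M i) (M j)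
  spectrum_subset : jointSpectrum M ⊆ polydisc d

/-- A radius in `(0, 1)` that is larger than the modulus of each coordinate of each joint
eigenvalue of `M` (for `M` with joint spectrum in the polydisc). -/
def evalRadius {d m : ℕ} (M : Fin d → Matrix (Fin m) (Fin m) ℂ) : ℝ :=
  (1 + sSup (norm '' jointSpectrum M)) / 2

/-- The product `(ξ¹ - M¹)⁻¹ ⋯ (ξᵈ - Mᵈ)⁻¹` of the resolvents. -/
def resolventProd {d m : ℕ} (M : Fin d → Matrix (Fin m) (Fin m) ℂ) (ξ : Fin d → ℂ) :
    Matrix (Fin m) (Fin m) ℂ :=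
  (List.ofFn fun i => (ξ i • (1 : Matrix (Fin m) (Fin m) ℂ) - M i)⁻¹).prod

/-- The value `f(M)` of a holomorphic function on the polydisc at a `d`-tuple of commuting
matrices with joint spectrum in the polydisc, by the Cauchy integral formula
`(2πi)⁻ᵈ ∫ f(ξ) (ξ¹ - M¹)⁻¹ ⋯ (ξᵈ - Mᵈ)⁻¹ dξ¹ ⋯ dξᵈ`. The integral (taken entrywise) is over a
torus inside the polydisc that surrounds the joint spectrum, so that no boundary values of `f` are
needed; by Cauchy's theorem the choice of the torus does not matter. -/
def matEval {d m : ℕ} (f : (Fin d → ℂ) → ℂ) (M : Fin d → Matrix (Fin m) (Fin m) ℂ) :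
    Matrix (Fin m) (Fin m) ℂ :=
  Matrix.of fun a b =>
    ((2 * (Real.pi : ℂ) * Complex.I) ^ d)⁻¹ *
      torusIntegral (fun ξ => f ξ * resolventProd M ξ a b) 0 (fun _ => evalRadius M)

/-- Extension by zero of a function on the polydisc. -/
def extendZero {d : ℕ} (f : polydisc d → ℂ) : (Fin d → ℂ) → ℂ :=
  Function.extend Subtype.val f 0

/-- An admissible kernel on the polydisc, given by its reproducing kernel Hilbert space `H`: a
Hilbert space of holomorphic functions on the polydisc with continuous point evaluations, on which
the multiplication by each coordinate function is a contraction. -/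
structure AdmissibleKernel (d : ℕ) where
  /-- The Hilbert space of functions. -/
  H : Type
  [normedAddCommGroup : NormedAddCommGroup H]
  [innerProductSpace : InnerProductSpace ℂ H]
  [completeSpace : CompleteSpace H]
  [rkhs : RKHS ℂ H (polydisc d) ℂ]
  holomorphic : ∀ f : H, DifferentiableOn ℂ (extendZero f) (polydisc d)
  contraction : ∀ (i : Fin d) (f : H), ∃ g : H, (∀ z : polydisc d, g z = z.1 i * f z) ∧ ‖g‖ ≤ ‖f‖

attribute [instance] AdmissibleKernel.normedAddCommGroup AdmissibleKernel.innerProductSpace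
  AdmissibleKernel.completeSpace AdmissibleKernel.rkhs

/-! ### Existence of the vectors that represent `f ↦ ⟨f(M) u, v⟩` -/

theorem extendZero_apply {d : ℕ} (f : polydisc d → ℂ) (z : polydisc d) :
    extendZero f z.1 = f z :=
  Subtype.val_injective.extend_apply f 0 z

theorem exists_joint_eigenvector {d m : ℕ} {M : Fin d → Matrix (Fin m) (Fin m) ℂ}
    (hM : ∀ i j, Commute (M i) (M j)) (W : Submodule ℂ (Fin m → ℂ)) (hW : W ≠ ⊥)
    (hinv : ∀ i, ∀ x ∈ W, M i *ᵥ x ∈ W) (S : Finset (Fin d)) :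
    ∃ W' : Submodule ℂ (Fin m → ℂ), W' ≤ W ∧ W' ≠ ⊥ ∧ (∀ i, ∀ x ∈ W', M i *ᵥ x ∈ W') ∧
      ∀ i ∈ S, ∃ c : ℂ, ∀ x ∈ W', M i *ᵥ x = c • x := by
  classical
  induction S using Finset.induction_on with
  | empty => exact ⟨W, le_rfl, hW, hinv, by simp⟩
  | insert j S hj ih =>
    obtain ⟨W', hle, hne, hinv', hS⟩ := ih
    let T : Module.End ℂ (Fin m → ℂ) := Matrix.toLin' (M j)
    have hT : ∀ x ∈ W', T x ∈ W' := fun x hx => by simpa [T] using hinv' j x hx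
    have : Nontrivial W' := Submodule.nontrivial_iff_ne_bot.mpr hne
    obtain ⟨c, hc⟩ := Module.End.exists_eigenvalue (T.restrict hT)
    obtain ⟨x, hx⟩ := hc.exists_hasEigenvector
    have hx1 : T x.1 = c • x.1 := by
      have := congrArg Subtype.val hx.apply_eq_smul
      simpa using this
    refine ⟨W' ⊓ Module.End.eigenspace T c, inf_le_left.trans hle, ?_, ?_, ?_⟩
    · intro h
      have : x.1 ∈ W' ⊓ Module.End.eigenspace T c :=
        ⟨x.2, Module.End.mem_eigenspace_iff.mpr hx1⟩
      rw [h, Submodule.mem_bot] at this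
      exact hx.2 (Subtype.ext this)
    · rintro i y ⟨hy, hy2⟩
      refine ⟨hinv' i y hy, ?_⟩
      have hy2 := Module.End.mem_eigenspace_iff.mp hy2
      refine Module.End.mem_eigenspace_iff.mpr ?_
      simp only [T, Matrix.toLin'_apply] at hy2 ⊢
      rw [Matrix.mulVec_mulVec, (hM j i).eq, ← Matrix.mulVec_mulVec, hy2, Matrix.mulVec_smul]
    · intro i hi
      rcases Finset.mem_insert.mp hi with rfl | hi
      · exact ⟨c, fun y hy => by
          simpa [T] using Module.End.mem_eigenspace_iff.mp hy.2⟩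
      · obtain ⟨c', hc'⟩ := hS i hi
        exact ⟨c', fun y hy => hc' y hy.1⟩

theorem exists_mem_jointSpectrum {d m : ℕ} {M : Fin d → Matrix (Fin m) (Fin m) ℂ}
    (hM : ∀ i j, Commute (M i) (M j)) (i : Fin d) (c : ℂ)
    (hc : (c • (1 : Matrix (Fin m) (Fin m) ℂ) - M i).det = 0) :
    ∃ lam ∈ jointSpectrum M, lam i = c := by
  classical
  obtain ⟨x, hx0, hx⟩ := Matrix.exists_mulVec_eq_zero_iff.mpr hc
  rw [Matrix.sub_mulVec, Matrix.smul_mulVec, Matrix.one_mulVec, sub_eq_zero] at hx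
  let W : Submodule ℂ (Fin m → ℂ) := Module.End.eigenspace (Matrix.toLin' (M i)) c
  have hmem : ∀ y, y ∈ W ↔ M i *ᵥ y = c • y := fun y => by
    simp only [W, Module.End.mem_eigenspace_iff, Matrix.toLin'_apply]
  have hW : W ≠ ⊥ := fun h => by
    have : x ∈ W := (hmem x).mpr hx.symm
    rw [h, Submodule.mem_bot] at this
    exact hx0 this
  obtain ⟨W', hle, hne, -, hS⟩ := exists_joint_eigenvector hM W hW (fun j y hy => by
    rw [hmem] at hy ⊢
    rw [Matrix.mulVec_mulVec, (hM i j).eq, ← Matrix.mulVec_mulVec, hy, Matrix.mulVec_smul])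
    Finset.univ
  obtain ⟨y, hy, hy0⟩ := W'.ne_bot_iff.mp hne
  choose lam hlam using fun j => hS j (Finset.mem_univ j)
  refine ⟨lam, ⟨y, hy0, fun j => hlam j y hy⟩, ?_⟩
  have h1 := hlam i y hy
  rw [(hmem y).mp (hle hy)] at h1
  exact (smul_left_injective ℂ hy0 h1).symm

theorem finite_jointSpectrum {d m : ℕ} (M : Fin d → Matrix (Fin m) (Fin m) ℂ) :
    (jointSpectrum M).Finite := by
  classical
  refine (Set.Finite.pi' (fun i : Fin d =>
    Module.End.finite_hasEigenvalue (Matrix.toLin' (M i)))).subset ?_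
  rintro lam ⟨x, hx0, hx⟩ i
  refine Module.End.hasEigenvalue_of_hasEigenvector (x := x) ⟨?_, hx0⟩
  exact Module.End.mem_eigenspace_iff.mpr (by simpa using hx i)

theorem norm_lt_one_of_mem_polydisc {d : ℕ} {z : Fin d → ℂ} (hz : z ∈ polydisc d) : ‖z‖ < 1 :=
  (pi_norm_lt_iff one_pos).mpr hz

theorem IsNode.sSup_lt_one {d m : ℕ} {M : Fin d → Matrix (Fin m) (Fin m) ℂ} (hM : IsNode M) :
    0 ≤ sSup (norm '' jointSpectrum M) ∧ sSup (norm '' jointSpectrum M) < 1 := by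
  refine ⟨Real.sSup_nonneg (by rintro _ ⟨z, -, rfl⟩; exact norm_nonneg z), ?_⟩
  rcases (norm '' jointSpectrum M).eq_empty_or_nonempty with h | h
  · rw [h, Real.sSup_empty]; exact one_pos
  · obtain ⟨z, hz, h1⟩ := h.csSup_mem ((finite_jointSpectrum M).image norm)
    rw [← h1]
    exact norm_lt_one_of_mem_polydisc (hM.spectrum_subset hz)

theorem IsNode.det_ne_zero {d m : ℕ} {M : Fin d → Matrix (Fin m) (Fin m) ℂ} (hM : IsNode M)
    (i : Fin d) {c : ℂ} (hc : ‖c‖ = evalRadius M) :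
    (c • (1 : Matrix (Fin m) (Fin m) ℂ) - M i).det ≠ 0 := by
  intro h
  obtain ⟨lam, hlam, rfl⟩ := exists_mem_jointSpectrum hM.commute i c h
  have h1 : ‖lam‖ ≤ sSup (norm '' jointSpectrum M) :=
    le_csSup ((finite_jointSpectrum M).image norm).bddAbove ⟨lam, hlam, rfl⟩
  have h2 := norm_le_pi_norm lam i
  have h3 := hM.sSup_lt_one
  rw [hc, evalRadius] at h2
  linarith

theorem IsNode.norm_torusMap {d m : ℕ} {M : Fin d → Matrix (Fin m) (Fin m) ℂ} (hM : IsNode M)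
    (θ : Fin d → ℝ) (i : Fin d) :
    ‖torusMap 0 (fun _ => evalRadius M) θ i‖ = evalRadius M := by
  have h : 0 ≤ evalRadius M := by have := hM.sSup_lt_one; unfold evalRadius; linarith
  simp [torusMap, Complex.norm_exp_ofReal_mul_I, abs_of_nonneg h]

theorem continuous_torusMap_zero {d : ℕ} (R : Fin d → ℝ) : Continuous (torusMap 0 R) := by
  unfold torusMap; fun_prop

theorem isCompact_torus {d : ℕ} (r : ℝ) : IsCompact {z : Fin d → ℂ | ∀ i, ‖z i‖ = r} := by
  have h : {z : Fin d → ℂ | ∀ i, ‖z i‖ = r} = Set.univ.pi fun _ => Metric.sphere (0 : ℂ) r := by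
    ext z; simp
  rw [h]
  exact isCompact_univ_pi fun _ => isCompact_sphere _ _

theorem IsNode.continuousOn_resolventProd {d m : ℕ} {M : Fin d → Matrix (Fin m) (Fin m) ℂ}
    (hM : IsNode M) :
    ContinuousOn (resolventProd M) {z : Fin d → ℂ | ∀ i, ‖z i‖ = evalRadius M} := by
  rw [continuousOn_iff_continuous_domRestrict]
  have h : ∀ i : Fin d, Continuous fun z : {z : Fin d → ℂ | ∀ i, ‖z i‖ = evalRadius M} =>
      (z.1 i • (1 : Matrix (Fin m) (Fin m) ℂ) - M i)⁻¹ := by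
    intro i
    have hc : Continuous fun z : {z : Fin d → ℂ | ∀ i, ‖z i‖ = evalRadius M} =>
        z.1 i • (1 : Matrix (Fin m) (Fin m) ℂ) - M i :=
      (((continuous_apply i).comp continuous_subtype_val).smul continuous_const).sub
        continuous_const
    simp only [Matrix.inv_def, Ring.inverse_eq_inv']
    exact (hc.matrix_det.inv₀ fun z => hM.det_ne_zero i (z.2 i)).smul hc.matrix_adjugate
  change Continuous fun z : {z : Fin d → ℂ | ∀ i, ‖z i‖ = evalRadius M} => resolventProd M z.1
  simp only [resolventProd, List.ofFn_eq_map]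
  exact continuous_list_prod _ fun i _ => h i

theorem AdmissibleKernel.exists_torus_functional {d m : ℕ} (k : AdmissibleKernel d)
    {M : Fin d → Matrix (Fin m) (Fin m) ℂ} (hM : IsNode M) (a b : Fin m) :
    ∃ L : k.H →L[ℂ] ℂ, ∀ f : k.H, L f =
      torusIntegral (fun ξ => extendZero f ξ * resolventProd M ξ a b) 0
        (fun _ => evalRadius M) := by
  set T : Set (Fin d → ℂ) := {z | ∀ i, ‖z i‖ = evalRadius M} with hT
  have hTm : ∀ θ, torusMap 0 (fun _ => evalRadius M) θ ∈ T := hM.norm_torusMap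
  have hTp : ∀ z ∈ T, z ∈ polydisc d := fun z hz i => by
    rw [hz i]
    have := hM.sSup_lt_one; unfold evalRadius; linarith
  have hTc : IsCompact T := isCompact_torus _
  have hr : ContinuousOn (fun ξ => resolventProd M ξ a b) T :=
    (continuous_apply_apply a b).comp_continuousOn hM.continuousOn_resolventProd
  have hf : ∀ f : k.H, ContinuousOn (extendZero f) T := fun f =>
    (k.holomorphic f).continuousOn.mono hTp
  have hint : ∀ f : k.H, TorusIntegrable (fun ξ => extendZero f ξ * resolventProd M ξ a b) 0
      (fun _ => evalRadius M) := fun f =>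
    (((hf f).mul hr).comp_continuous (continuous_torusMap_zero _) hTm).integrableOn_Icc
  -- uniform boundedness of the point evaluations on the torus
  let ev : T → k.H →L[ℂ] ℂ := fun z =>
    (ContinuousLinearMap.proj (R := ℂ) (φ := fun _ : polydisc d => ℂ) ⟨z.1, hTp z z.2⟩).comp
      (RKHS.coeCLM ℂ)
  have hev : ∀ (z : T) (f : k.H), ev z f = extendZero f z.1 := fun z f =>
    (extendZero_apply f ⟨z.1, hTp z z.2⟩).symm
  obtain ⟨B, hB⟩ : ∃ B, ∀ z, ‖ev z‖ ≤ B := by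
    refine banach_steinhaus fun f => ?_
    obtain ⟨C, hC⟩ := hTc.exists_bound_of_continuousOn (hf f)
    exact ⟨C, fun z => by rw [hev]; exact hC z z.2⟩
  obtain ⟨C, hC⟩ := hTc.exists_bound_of_continuousOn hr
  have hadd : ∀ f g : k.H, extendZero (⇑(f + g)) = extendZero f + extendZero g := fun f g => by
    rw [RKHS.coe_add]
    ext z
    by_cases hz : z ∈ polydisc d
    · lift z to polydisc d using hz
      simp [extendZero_apply]
    · have : ¬∃ y : polydisc d, y.1 = z := by rintro ⟨y, rfl⟩; exact hz y.2
      simp [extendZero, Function.extend_apply' _ _ _ this]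
  have hsmul : ∀ (c : ℂ) (f : k.H), extendZero (⇑(c • f)) = c • extendZero f := fun c f => by
    rw [RKHS.coe_smul]
    ext z
    by_cases hz : z ∈ polydisc d
    · lift z to polydisc d using hz
      simp [extendZero_apply]
    · have : ¬∃ y : polydisc d, y.1 = z := by rintro ⟨y, rfl⟩; exact hz y.2
      simp [extendZero, Function.extend_apply' _ _ _ this]
  let L₀ : k.H →ₗ[ℂ] ℂ :=
    { toFun := fun f => torusIntegral (fun ξ => extendZero f ξ * resolventProd M ξ a b) 0
        (fun _ => evalRadius M)
      map_add' := fun f g => by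
        rw [← torusIntegral_add (hint f) (hint g)]
        congr 1
        ext ξ
        rw [hadd, Pi.add_apply, add_mul]
      map_smul' := fun c f => by
        rw [RingHom.id_apply, ← torusIntegral_smul]
        congr 1
        ext ξ
        rw [hsmul, Pi.smul_apply, smul_mul_assoc] }
  refine ⟨L₀.mkContinuous ((2 * Real.pi) ^ d * (∏ _i : Fin d, |evalRadius M|) * (B * C))
    fun f => ?_, fun f => rfl⟩
  have hb : ∀ θ, ‖extendZero f (torusMap 0 (fun _ => evalRadius M) θ) *
      resolventProd M (torusMap 0 (fun _ => evalRadius M) θ) a b‖ ≤ B * ‖f‖ * C := fun θ => by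
    rw [norm_mul]
    have h1 : ‖extendZero f (torusMap 0 (fun _ => evalRadius M) θ)‖ ≤ B * ‖f‖ := by
      rw [← hev ⟨_, hTm θ⟩ f]
      exact (ev ⟨_, hTm θ⟩).le_of_opNorm_le (hB _) f
    exact mul_le_mul h1 (hC _ (hTm θ)) (norm_nonneg _) ((norm_nonneg _).trans h1)
  have h2 := norm_torusIntegral_le_of_norm_le_const
    (f := fun ξ => extendZero f ξ * resolventProd M ξ a b) hb
  refine h2.trans (le_of_eq ?_)
  ring

/-- For a node `M` and vectors `u`, `v`, the functional `f ↦ ⟨f(M) u, v⟩` is represented by a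
unique vector. (Mathlib's inner product is conjugate-linear in its first argument.) -/
theorem AdmissibleKernel.existsUnique_nodeKernel {d m : ℕ} (k : AdmissibleKernel d)
    {M : Fin d → Matrix (Fin m) (Fin m) ℂ} (hM : IsNode M) (u v : Fin m → ℂ) :
    ∃! K : k.H, ∀ f : k.H, inner ℂ K f = star v ⬝ᵥ (matEval (extendZero f) M *ᵥ u) := by
  choose L hL using fun a b => k.exists_torus_functional hM a b
  let Φ : k.H →L[ℂ] ℂ :=
    ∑ a, ∑ b, (star v a * (((2 * (Real.pi : ℂ) * Complex.I) ^ d)⁻¹ * u b)) • L a b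
  have hΦ : ∀ f : k.H, Φ f = star v ⬝ᵥ (matEval (extendZero f) M *ᵥ u) := by
    intro f
    simp only [Φ, sum_apply, smul_apply, hL, dotProduct,
      Matrix.mulVec, matEval, Matrix.of_apply, Finset.mul_sum, smul_eq_mul]
    exact Finset.sum_congr rfl fun a _ => Finset.sum_congr rfl fun b _ => by ring
  refine ⟨(InnerProductSpace.toDual ℂ k.H).symm Φ, fun f => ?_, fun K hK => ?_⟩
  · rw [← hΦ, InnerProductSpace.toDual_symm_apply]
  · refine ext_inner_right ℂ fun f => ?_
    rw [hK, ← hΦ, InnerProductSpace.toDual_symm_apply]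

/-- The vector `K_M(u, v)` of the reproducing kernel Hilbert space, determined by
`⟨f, K_M(u, v)⟩ = ⟨f(M) u, v⟩` for all `f`. -/
def AdmissibleKernel.nodeKernel {d m : ℕ} (k : AdmissibleKernel d)
    {M : Fin d → Matrix (Fin m) (Fin m) ℂ} (hM : IsNode M) (u v : Fin m → ℂ) : k.H :=
  (k.existsUnique_nodeKernel hM u v).choose

theorem AdmissibleKernel.inner_nodeKernel {d m : ℕ} (k : AdmissibleKernel d)
    {M : Fin d → Matrix (Fin m) (Fin m) ℂ} (hM : IsNode M) (u v : Fin m → ℂ) (f : k.H) :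
    inner ℂ (k.nodeKernel hM u v) f = star v ⬝ᵥ (matEval (extendZero f) M *ᵥ u) :=
  (k.existsUnique_nodeKernel hM u v).choose_spec.1 f

/-- The reproducing kernel function `k_z` at the point `z`: `⟨f, k_z⟩ = f(z)` for all `f`. -/
def AdmissibleKernel.pointKernel {d : ℕ} (k : AdmissibleKernel d) (z : polydisc d) : k.H :=
  RKHS.kerFun k.H z 1

/-! ### The operators -/

section operators

variable {d N : ℕ} (k : AdmissibleKernel d) {s : Fin N → ℕ}
  {A : ∀ j, Fin d → Matrix (Fin (s j)) (Fin (s j)) ℂ} (hA : ∀ j, IsNode (A j))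
  (φ : Fin N → (Fin d → ℂ) → ℂ) (z : polydisc d) (w : ℂ)

/-- The span `H₀` of all vectors `K_{A_j}(u, v)`. -/
def AdmissibleKernel.nodeSpace : Submodule ℂ k.H :=
  Submodule.span ℂ {x | ∃ j u v, x = k.nodeKernel (hA j) u v}

/-- The span `H₁` of `H₀` and `k_z`. -/
def AdmissibleKernel.nodeSpaceExt : Submodule ℂ k.H :=
  k.nodeSpace hA ⊔ Submodule.span ℂ {k.pointKernel z}

theorem AdmissibleKernel.nodeKernel_mem (j : Fin N) (u v : Fin (s j) → ℂ) :
    k.nodeKernel (hA j) u v ∈ k.nodeSpace hA :=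
  Submodule.subset_span ⟨j, u, v, rfl⟩

theorem AdmissibleKernel.nodeKernel_mem_ext (j : Fin N) (u v : Fin (s j) → ℂ) :
    k.nodeKernel (hA j) u v ∈ k.nodeSpaceExt hA z :=
  Submodule.mem_sup_left (k.nodeKernel_mem hA j u v)

theorem AdmissibleKernel.pointKernel_mem_ext :
    k.pointKernel z ∈ k.nodeSpaceExt hA z :=
  Submodule.mem_sup_right (Submodule.mem_span_singleton_self _)

/-- `R : H₀ → H₀` satisfies `R (K_{A_j}(u, v)) = K_{A_j}(u, φ_j(A_j)^* v)` for all `j, u, v`. There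
is at most one such `R`. -/
def AdmissibleKernel.IsR (R : k.nodeSpace hA →L[ℂ] k.nodeSpace hA) : Prop :=
  ∀ j u v, R ⟨k.nodeKernel (hA j) u v, k.nodeKernel_mem hA j u v⟩ =
    ⟨k.nodeKernel (hA j) u ((matEval (φ j) (A j))ᴴ *ᵥ v), k.nodeKernel_mem hA j u _⟩

/-- `R : H₁ → H₁` satisfies `R (K_{A_j}(u, v)) = K_{A_j}(u, φ_j(A_j)^* v)` for all `j, u, v`, and
`R k_z = w̄ k_z`. There is at most one such `R`. -/
def AdmissibleKernel.IsRExt (R : k.nodeSpaceExt hA z →L[ℂ] k.nodeSpaceExt hA z) : Prop :=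
  (∀ j u v, R ⟨k.nodeKernel (hA j) u v, k.nodeKernel_mem_ext hA z j u v⟩ =
    ⟨k.nodeKernel (hA j) u ((matEval (φ j) (A j))ᴴ *ᵥ v), k.nodeKernel_mem_ext hA z j u _⟩) ∧
  R ⟨k.pointKernel z, k.pointKernel_mem_ext hA z⟩ =
    conj w • ⟨k.pointKernel z, k.pointKernel_mem_ext hA z⟩

/-- The operator norm of the operator `R^k : H₀ → H₀` with
`R^k (K_{A_j}(u, v)) = K_{A_j}(u, φ_j(A_j)^* v)`. It is `∞` if there is no such operator, that is,
if this formula is inconsistent. -/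
def AdmissibleKernel.normR : ℝ≥0∞ := ⨅ (R) (_ : k.IsR hA φ R), ‖R‖ₑ

/-- The operator norm of the operator on `H₁` that extends `R^k` by `k_z ↦ w̄ k_z`. It is `∞` if
there is no such operator. -/
def AdmissibleKernel.normRExt : ℝ≥0∞ := ⨅ (R) (_ : k.IsRExt hA φ z w R), ‖R‖ₑ

end operators

end

/-!
Let `β` be the tuple of the values `φ_j(A_j)`, an element of the finite-dimensional algebra
`∏ M_{s_j}`, in which the coordinate tuples `X_i = (A_j^i)_j` act by multiplication. If `H ≥ 0` is a
form on this algebra with `X_i* H X_i ≤ H` for all `i`, then adding `H(f(A))` to the squared norm of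
an admissible space gives an admissible kernel. Testing `‖R^k‖ ≤ C` on these kernels and scaling `H`
yields `H(β) ≤ C² H(1)` for all such `H`. By cone duality `C² 1 1* - β β*` is a sum of
terms `Γ_i - X_i Γ_i X_i*` with `Γ_i ≥ 0`, and a lurking isometry argument turns this
decomposition into a contractive matrix `U` whose transfer function `ψ` satisfies
`C ψ(A_j) = φ_j(A_j)`.

Such a `ψ` is bounded by `1`, and multiplication by `ψ` is a contraction on every admissible space.
Its adjoint maps `k_z` to `conj (ψ z) k_z`, so for `w = C ψ(z)` every `R^k` extends with norm at
most `C`.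
-/

open Filter Topology MeasureTheory Metric
open scoped Real

noncomputable section

/-! ### Torus integrals -/

section TorusIntegral

theorem norm_torusMap_zero {n : ℕ} {R : ℝ} (hR : 0 ≤ R) (θ : Fin n → ℝ) (i : Fin n) :
    ‖torusMap 0 (fun _ => R) θ i‖ = R := by
  simp [torusMap, Complex.norm_exp_ofReal_mul_I, abs_of_nonneg hR]

theorem torusIntegrable_of_continuousOn {E : Type*} [NormedAddCommGroup E] {n : ℕ} {R : ℝ}
    (hR : 0 ≤ R) {f : (Fin n → ℂ) → E}
    (hf : ContinuousOn f {ξ | ∀ i, ‖ξ i‖ = R}) : TorusIntegrable f 0 (fun _ => R) :=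
  (hf.comp_continuous (continuous_torusMap_zero _) (norm_torusMap_zero hR)).integrableOn_Icc

variable {E F : Type*} [NormedAddCommGroup E] [NormedSpace ℂ E] [NormedAddCommGroup F]
  [NormedSpace ℂ F] {n : ℕ}

theorem torusIntegral_clm_apply [CompleteSpace E] [CompleteSpace F] (L : E →L[ℂ] F)
    {f : (Fin n → ℂ) → E} {c : Fin n → ℂ} {R : Fin n → ℝ} (hf : TorusIntegrable f c R) :
    torusIntegral (fun ξ => L (f ξ)) c R = L (torusIntegral f c R) := by
  simp only [torusIntegral, ← map_smul]
  exact L.integral_comp_comm hf.function_integrable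

theorem torusIntegral_eq_torusIntegral_circleIntegral {f : (Fin (n + 1) → ℂ) → E}
    {c : Fin (n + 1) → ℂ} {R : Fin (n + 1) → ℝ} (hf : TorusIntegrable f c R) (i : Fin (n + 1)) :
    torusIntegral f c R = torusIntegral (fun y => ∮ x in C(c i, R i), f (i.insertNth x y))
      (c ∘ i.succAbove) (R ∘ i.succAbove) := by
  set e : ℝ × (Fin n → ℝ) ≃ᵐ (Fin (n + 1) → ℝ) :=
    (MeasurableEquiv.piFinSuccAbove (fun _ => ℝ) i).symm
  have he : MeasurePreserving e :=
    (volume_preserving_piFinSuccAbove (fun _ : Fin (n + 1) => ℝ) i).symm _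
  have hbox : (e ⁻¹' Set.Icc 0 fun _ => 2 * π) =
      Set.Icc 0 (2 * π) ×ˢ Set.Icc (0 : Fin n → ℝ) fun _ => 2 * π :=
    ((Fin.insertNthOrderIso (fun _ => ℝ) i).preimage_Icc _ _).trans (Set.Icc_prod_eq _ _)
  have hint := hf.function_integrable
  rw [← he.integrableOn_comp_preimage e.measurableEmbedding, hbox, Measure.volume_eq_prod] at hint
  rw [torusIntegral, ← he.map_eq, setIntegral_map_equiv, hbox, Measure.volume_eq_prod,
    ← Measure.prod_restrict, integral_prod_symm _ (by rwa [Measure.prod_restrict]), torusIntegral]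
  simp only [circleIntegral_def_Icc, ← integral_smul]
  refine integral_congr_ae (.of_forall fun Θ => integral_congr_ae (.of_forall fun θ => ?_))
  have hpt : torusMap c R (e (θ, Θ)) = i.insertNth (circleMap (c i) (R i) θ)
      (torusMap (c ∘ i.succAbove) (R ∘ i.succAbove) Θ) := by
    simp [funext_iff, i.forall_iff_succAbove, circleMap, torusMap, e, Fin.insertNthEquiv]
  beta_reduce
  rw [hpt]
  simp only [i.prod_univ_succAbove _, deriv_circleMap, circleMap_zero, smul_smul, e,
    MeasurableEquiv.piFinSuccAbove_symm_apply, Fin.insertNthEquiv, Equiv.coe_fn_mk,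
    i.insertNth_apply_same, i.insertNth_apply_succAbove, Function.comp_apply, mul_comm]

theorem torusIntegral_congr {R : ℝ} (hR : 0 ≤ R) {f g : (Fin n → ℂ) → E}
    (h : Set.EqOn f g {ξ | ∀ i, ‖ξ i‖ = R}) :
    torusIntegral f 0 (fun _ => R) = torusIntegral g 0 (fun _ => R) := by
  simp only [torusIntegral, fun θ => h (norm_torusMap_zero (n := n) hR θ)]

end TorusIntegral

theorem circleIntegral_eq_of_tendsto_smul_cobounded {E : Type*} [NormedAddCommGroup E]
    [NormedSpace ℂ E] [CompleteSpace E] {f : ℂ → E} {R : ℝ} {c : E} (hR : 0 < R)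
    (hf : ∀ ξ, R ≤ ‖ξ‖ → DifferentiableAt ℂ f ξ)
    (hc : Tendsto (fun ξ => ξ • f ξ) (Bornology.cobounded ℂ) (𝓝 c)) :
    (∮ ξ in C(0, R), f ξ) = (2 * π * Complex.I : ℂ) • c := by
  refine eq_of_forall_dist_le fun ε hε => ?_
  have hε' : 0 < ε / (2 * π) := by positivity
  obtain ⟨R₀, hR₀⟩ : ∃ R₀, ∀ ξ, R₀ ≤ ‖ξ‖ → dist (ξ • f ξ) c < ε / (2 * π) := by
    simpa using hasBasis_cobounded_norm.eventually_iff.mp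
      (hc.eventually_mem (ball_mem_nhds c hε'))
  set S := max R R₀
  have hS : 0 < S := hR.trans_le (le_max_left _ _)
  have hcont : ContinuousOn f (sphere 0 S) := fun ξ hξ =>
    (hf ξ ((le_max_left R R₀).trans_eq (by simpa using hξ.symm))).continuousAt.continuousWithinAt
  have hRS : (∮ ξ in C(0, R), f ξ) = ∮ ξ in C(0, S), f ξ :=
    (Complex.circleIntegral_eq_of_differentiable_on_annulus_off_countable hR (le_max_left _ _)
      Set.countable_empty
      (fun ξ hξ => (hf ξ (by simpa using hξ.2)).continuousAt.continuousWithinAt)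
      (fun ξ hξ => hf ξ (le_of_lt (by simpa using hξ.1.2)))).symm
  have hpole : (∮ ξ in C(0, S), ξ⁻¹ • c) = (2 * π * Complex.I : ℂ) • c := by
    rw [circleIntegral.integral_smul_const]
    simpa using congrArg (· • c) (circleIntegral.integral_sub_center_inv 0 hS.ne')
  have hint : CircleIntegrable (fun ξ : ℂ => ξ⁻¹ • c) 0 S := by
    refine ContinuousOn.circleIntegrable hS.le ((continuousOn_id.inv₀ fun ξ hξ => ?_).smul
      continuousOn_const)
    exact ne_of_mem_sphere hξ hS.ne'
  rw [hRS, ← hpole, dist_eq_norm,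
    ← circleIntegral.integral_sub (hcont.circleIntegrable hS.le) hint]
  refine (circleIntegral.norm_integral_le_of_norm_le_const (C := S⁻¹ * (ε / (2 * π))) hS.le
    fun ξ hξ => ?_).trans_eq (by field_simp)
  have hξS : ‖ξ‖ = S := by simpa using hξ
  have hξ0 : ξ ≠ 0 := ne_of_mem_sphere hξ hS.ne'
  calc ‖f ξ - ξ⁻¹ • c‖ = ‖ξ⁻¹ • (ξ • f ξ - c)‖ := by rw [smul_sub, inv_smul_smul₀ hξ0]
    _ = S⁻¹ * dist (ξ • f ξ) c := by rw [norm_smul, norm_inv, hξS, dist_eq_norm]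
    _ ≤ S⁻¹ * (ε / (2 * π)) := by
      gcongr
      exact (hR₀ ξ (hξS ▸ le_max_right R R₀)).le

/-! ### Holomorphic functional calculus -/

section Resolvent

variable {𝔸 : Type*} [NormedRing 𝔸] [NormedAlgebra ℂ 𝔸] [CompleteSpace 𝔸]

theorem mem_resolventSet_of_spectrum_subset_ball {𝔸 : Type*} [Ring 𝔸] [Algebra ℂ 𝔸] {a : 𝔸}
    {R : ℝ} (ha : spectrum ℂ a ⊆ ball 0 R) {ξ : ℂ} (hξ : R ≤ ‖ξ‖) : ξ ∈ resolventSet ℂ a :=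
  by_contra fun h => by simpa [hξ.not_gt] using ha h

theorem tendsto_smul_resolvent_cobounded (a : 𝔸) :
    Tendsto (fun ξ : ℂ => ξ • resolvent a ξ) (Bornology.cobounded ℂ) (𝓝 1) := by
  have hone : Tendsto (fun ξ : ℂ => 1 - ξ⁻¹ • a) (Bornology.cobounded ℂ) (𝓝 1) := by
    simpa using (tendsto_inv₀_cobounded (α := ℂ)).smul_const a |>.const_sub 1
  have hinv : Tendsto (fun ξ : ℂ => Ring.inverse (1 - ξ⁻¹ • a)) (Bornology.cobounded ℂ) (𝓝 1) := by
    simpa [Function.comp_def] using (NormedRing.inverse_continuousAt (1 : 𝔸ˣ)).tendsto.comp hone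
  refine hinv.congr' ?_
  filter_upwards [Bornology.isBounded_def.mp (Bornology.isBounded_singleton (x := (0 : ℂ)))]
    with ξ hξ
  lift ξ to ℂˣ using isUnit_iff_ne_zero.mpr hξ
  simpa [resolvent, Units.smul_def] using
    (spectrum.units_smul_resolvent_self (r := ξ) (a := a)).symm

theorem circleIntegral_resolvent {a : 𝔸} {R : ℝ} (hR : 0 < R) (ha : spectrum ℂ a ⊆ ball 0 R) :
    (∮ ξ in C(0, R), resolvent a ξ) = (2 * π * Complex.I : ℂ) • (1 : 𝔸) :=
  circleIntegral_eq_of_tendsto_smul_cobounded hR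
    (fun _ hξ => (spectrum.hasDerivAt_resolvent_const_left
      (mem_resolventSet_of_spectrum_subset_ball ha hξ)).differentiableAt)
    (tendsto_smul_resolvent_cobounded a)

theorem tendsto_pow_of_spectrum_subset_ball {a : 𝔸} (ha : spectrum ℂ a ⊆ ball 0 1) :
    Tendsto (fun n => a ^ n) atTop (𝓝 0) := by
  nontriviality 𝔸
  obtain ⟨q, hq, hq1⟩ := ENNReal.lt_iff_exists_nnreal_btwn.mp
    (spectrum.spectralRadius_lt_of_forall_lt a (r := 1) fun ξ hξ => by
      simpa [← NNReal.coe_lt_coe] using ha hξ)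
  have hpow : ∀ᶠ n in atTop, ‖a ^ n‖ ≤ (q : ℝ) ^ n := by
    have hroot := spectrum.pow_nnnorm_pow_one_div_tendsto_nhds_spectralRadius a
    filter_upwards [hroot.eventually_lt_const hq, eventually_ne_atTop 0] with n hn hn0
    have h := ENNReal.rpow_le_rpow hn.le (Nat.cast_nonneg (α := ℝ) n)
    rw [← ENNReal.rpow_mul, one_div_mul_cancel (Nat.cast_ne_zero.mpr hn0), ENNReal.rpow_one,
      ENNReal.rpow_natCast] at h
    exact_mod_cast h
  exact squeeze_zero_norm' hpow
    (tendsto_pow_atTop_nhds_zero_of_lt_one q.2 (by exact_mod_cast hq1))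

/-- The product `(ξ¹ - a¹)⁻¹ ⋯ (ξᵈ - aᵈ)⁻¹` of the resolvents of a tuple in a complex algebra, the
kernel of the Cauchy formula for the holomorphic functional calculus of the tuple. -/
def resolventProduct {𝔸 : Type*} [Ring 𝔸] [Algebra ℂ 𝔸] {d : ℕ} (a : Fin d → 𝔸)
    (ξ : Fin d → ℂ) : 𝔸 :=
  (List.ofFn fun i => resolvent (a i) (ξ i)).prod

theorem resolventProduct_cons {𝔸 : Type*} [Ring 𝔸] [Algebra ℂ 𝔸] {d : ℕ} (a : Fin (d + 1) → 𝔸)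
    (x : ℂ) (y : Fin d → ℂ) :
    resolventProduct a (Fin.cons x y) = resolvent (a 0) x * resolventProduct (Fin.tail a) y := by
  simp [resolventProduct, List.ofFn_succ, Fin.tail]

theorem commute_resolvent {𝔸 : Type*} [Ring 𝔸] [Algebra ℂ 𝔸] {x a : 𝔸} (h : Commute x a) (ξ : ℂ) :
    Commute x (resolvent a ξ) := by
  have h1 : Commute x (algebraMap ℂ 𝔸 ξ - a) := (Algebra.commute_algebraMap_right ξ x).sub_right h
  by_cases hu : IsUnit (algebraMap ℂ 𝔸 ξ - a)
  · obtain ⟨u, hu⟩ := hu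
    rw [resolvent, ← hu, Ring.inverse_unit]
    exact (hu ▸ h1).units_inv_right
  · rw [resolvent, Ring.inverse_non_unit _ hu]
    exact Commute.zero_right x

theorem commute_resolventProduct {𝔸 : Type*} [Ring 𝔸] [Algebra ℂ 𝔸] {d : ℕ} {a : Fin d → 𝔸}
    {x : 𝔸} (h : ∀ i, Commute x (a i)) (ξ : Fin d → ℂ) : Commute x (resolventProduct a ξ) := by
  refine Commute.list_prod_right _ _ fun y hy => ?_
  obtain ⟨i, rfl⟩ := (List.mem_ofFn' _ _).mp hy
  exact commute_resolvent (h i) _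

theorem perm_ofFn_succAbove {α : Type*} {n : ℕ} (f : Fin (n + 1) → α) (i : Fin (n + 1)) :
    (List.ofFn f).Perm (f i :: List.ofFn fun j => f (i.succAbove j)) := by
  have h : (List.finRange (n + 1)).Perm (i :: (List.finRange n).map i.succAbove) := by
    refine (List.perm_ext_iff_of_nodup (List.nodup_finRange _) ?_).mpr fun j => ?_
    · refine List.nodup_cons.mpr ⟨?_, (List.nodup_finRange _).map Fin.succAbove_right_injective⟩
      simp [Fin.succAbove_ne]
    · simpa [eq_comm] using Fin.eq_self_or_eq_succAbove i j
  simpa only [List.ofFn_eq_map, List.map_cons, List.map_map, Function.comp_def] using h.map f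

theorem resolventProduct_insertNth {𝔸 : Type*} [Ring 𝔸] [Algebra ℂ 𝔸] {n : ℕ}
    {a : Fin (n + 1) → 𝔸} (ha : ∀ i j, Commute (a i) (a j)) (i : Fin (n + 1)) (x : ℂ)
    (y : Fin n → ℂ) : resolventProduct a (i.insertNth x y) =
      resolvent (a i) x * resolventProduct (fun j => a (i.succAbove j)) y := by
  have h := perm_ofFn_succAbove
    (fun j => resolvent (a j) ((i.insertNth x y : Fin (n + 1) → ℂ) j)) i
  simp only [i.insertNth_apply_same, i.insertNth_apply_succAbove] at h
  have hcomm : ∀ i j (ξ η : ℂ), Commute (resolvent (a i) ξ) (resolvent (a j) η) :=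
    fun i j ξ η => (commute_resolvent (commute_resolvent (ha i j) η).symm ξ).symm
  rw [resolventProduct, h.prod_eq', List.prod_cons, resolventProduct]
  exact List.pairwise_ofFn.mpr fun _ _ _ => hcomm _ _ _ _

theorem sub_mul_resolventProduct_insertNth {𝔸 : Type*} [Ring 𝔸] [Algebra ℂ 𝔸] {n : ℕ}
    {a : Fin (n + 1) → 𝔸} (ha : ∀ i j, Commute (a i) (a j)) (i : Fin (n + 1)) {x : ℂ}
    (hx : x ∈ resolventSet ℂ (a i)) (y : Fin n → ℂ) :
    (algebraMap ℂ 𝔸 x - a i) * resolventProduct a (i.insertNth x y) =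
      resolventProduct (fun j => a (i.succAbove j)) y := by
  rw [resolventProduct_insertNth ha, ← mul_assoc, resolvent, Ring.mul_inverse_cancel _ hx, one_mul]

variable {d : ℕ} {a : Fin d → 𝔸} {R : ℝ}

theorem continuousOn_resolventProduct (ha : ∀ i, spectrum ℂ (a i) ⊆ ball 0 R) :
    ContinuousOn (resolventProduct a) {ξ | ∀ i, ‖ξ i‖ = R} := by
  have h : ∀ i, ContinuousOn (fun ξ : Fin d → ℂ => resolvent (a i) (ξ i)) {ξ | ∀ i, ‖ξ i‖ = R} :=
    fun i ξ hξ => (ContinuousAt.comp (f := fun ξ : Fin d → ℂ => ξ i)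
      (spectrum.hasDerivAt_resolvent_const_left
        (mem_resolventSet_of_spectrum_subset_ball (ha i) (hξ i).ge)).continuousAt
      (continuous_apply i).continuousAt).continuousWithinAt
  unfold resolventProduct
  simp only [List.ofFn_eq_map]
  exact continuousOn_list_prod _ fun i _ => h i

theorem torusIntegral_resolventProduct (hR : 0 < R) (ha : ∀ i, spectrum ℂ (a i) ⊆ ball 0 R) :
    torusIntegral (resolventProduct a) 0 (fun _ => R) =
      ((2 * π * Complex.I) ^ d : ℂ) • (1 : 𝔸) := by
  induction d with
  | zero => simp [resolventProduct]
  | succ d ih =>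
    have htail : ∀ i, spectrum ℂ (Fin.tail a i) ⊆ ball 0 R := fun i => ha i.succ
    have inner (x : ℂ) :
        torusIntegral (fun y => resolvent (a 0) x * resolventProduct (Fin.tail a) y) 0 (fun _ => R)
          = ((2 * π * Complex.I) ^ d : ℂ) • resolvent (a 0) x := by
      have h := torusIntegral_clm_apply (ContinuousLinearMap.mul ℂ 𝔸 (resolvent (a 0) x))
        (torusIntegrable_of_continuousOn hR.le (continuousOn_resolventProduct htail))
      simpa [ih htail] using h
    rw [torusIntegral_succ
      (torusIntegrable_of_continuousOn hR.le (continuousOn_resolventProduct ha))]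
    simp only [resolventProduct_cons, Function.comp_def, Pi.zero_apply]
    calc _ = ∮ x in C(0, R), ((2 * π * Complex.I) ^ d : ℂ) • resolvent (a 0) x := by
          simp only [← inner]; rfl
      _ = _ := by
        rw [circleIntegral.integral_smul, circleIntegral_resolvent hR (ha 0), smul_smul, pow_succ]

theorem isOpen_polydisc : IsOpen (polydisc d) := by
  simp only [polydisc, Set.ofPred_forall]
  exact isOpen_iInter_of_finite fun i : Fin d => isOpen_lt (by fun_prop) continuous_const

theorem mem_polydisc_of_norm_eq (hR : R < 1) {ξ : Fin d → ℂ} (hξ : ∀ i, ‖ξ i‖ = R) :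
    ξ ∈ polydisc d := fun i => (hξ i).trans_lt hR

theorem circleIntegral_insertNth_eq_zero {n : ℕ} {f : (Fin (n + 1) → ℂ) → ℂ}
    (hf : DifferentiableOn ℂ f (polydisc (n + 1))) (hR₀ : 0 ≤ R) (hR : R < 1) {y : Fin n → ℂ}
    (hy : y ∈ polydisc n) (i : Fin (n + 1)) : (∮ x in C(0, R), f (i.insertNth x y)) = 0 := by
  have hmem : ∀ x ∈ closedBall (0 : ℂ) R, i.insertNth x y ∈ polydisc (n + 1) := fun x hx => by
    have hx : ‖x‖ < 1 := lt_of_le_of_lt (by simpa using hx) hR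
    simpa [polydisc, i.forall_iff_succAbove, hx] using hy
  have hdiff : ∀ x ∈ closedBall (0 : ℂ) R, DifferentiableAt ℂ (fun x => f (i.insertNth x y)) x := by
    refine fun x hx => (hf.differentiableAt (isOpen_polydisc.mem_nhds (hmem x hx))).comp x ?_
    rw [differentiableAt_pi, i.forall_iff_succAbove]
    simp
  exact Complex.circleIntegral_eq_zero_of_differentiable_on_off_countable hR₀ Set.countable_empty
    (fun x hx => (hdiff x hx).continuousAt.continuousWithinAt)
    fun x hx => hdiff x (ball_subset_closedBall hx.1)

theorem torusIntegrable_smul_resolventProduct (hR₀ : 0 ≤ R) (hR : R < 1)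
    (ha : ∀ i, spectrum ℂ (a i) ⊆ ball 0 R) {f : (Fin d → ℂ) → ℂ}
    (hf : ContinuousOn f (polydisc d)) :
    TorusIntegrable (fun ξ => f ξ • resolventProduct a ξ) 0 (fun _ => R) :=
  torusIntegrable_of_continuousOn hR₀
    ((hf.mono fun _ => mem_polydisc_of_norm_eq hR).smul (continuousOn_resolventProduct ha))

theorem torusIntegral_smul_sub_mul_resolventProduct (hR₀ : 0 ≤ R) (hR : R < 1)
    (ha : ∀ i, spectrum ℂ (a i) ⊆ ball 0 R) (hcomm : ∀ i j, Commute (a i) (a j))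
    {f : (Fin d → ℂ) → ℂ} (hf : DifferentiableOn ℂ f (polydisc d)) (i : Fin d) :
    torusIntegral (fun ξ => f ξ • ((algebraMap ℂ 𝔸 (ξ i) - a i) * resolventProduct a ξ)) 0
      (fun _ => R) = 0 := by
  obtain _ | n := d
  · exact i.elim0
  have hint : ContinuousOn
      (fun ξ => f ξ • ((algebraMap ℂ 𝔸 (ξ i) - a i) * resolventProduct a ξ)) {ξ | ∀ i, ‖ξ i‖ = R} :=
    (hf.continuousOn.mono fun _ => mem_polydisc_of_norm_eq hR).smul
      ((by fun_prop : Continuous fun ξ : Fin (n + 1) → ℂ =>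
        algebraMap ℂ 𝔸 (ξ i) - a i).continuousOn.mul (continuousOn_resolventProduct ha))
  rw [torusIntegral_eq_torusIntegral_circleIntegral (torusIntegrable_of_continuousOn hR₀ hint) i]
  have inner : Set.EqOn (fun y => ∮ x in C(0, R), f (i.insertNth x y) •
      ((algebraMap ℂ 𝔸 x - a i) * resolventProduct a (i.insertNth x y))) 0
      {y : Fin n → ℂ | ∀ j, ‖y j‖ = R} := fun y hy => by
    beta_reduce
    rw [circleIntegral.integral_congr hR₀ (g := fun x => f (i.insertNth x y) •
      resolventProduct (fun j => a (i.succAbove j)) y) fun x hx => ?_]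
    · rw [circleIntegral.integral_smul_const, circleIntegral_insertNth_eq_zero hf hR₀ hR
        (mem_polydisc_of_norm_eq hR hy), zero_smul, Pi.zero_apply]
    · beta_reduce
      rw [sub_mul_resolventProduct_insertNth hcomm i
        (mem_resolventSet_of_spectrum_subset_ball (ha i) (by simpa using hx.ge))]
  simp only [i.insertNth_apply_same]
  exact (torusIntegral_congr hR₀ inner).trans (by simp [torusIntegral])

theorem torusIntegral_coord_mul_smul_resolventProduct (hR₀ : 0 ≤ R) (hR : R < 1)
    (ha : ∀ i, spectrum ℂ (a i) ⊆ ball 0 R) (hcomm : ∀ i j, Commute (a i) (a j))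
    {f : (Fin d → ℂ) → ℂ} (hf : DifferentiableOn ℂ f (polydisc d)) (i : Fin d) :
    torusIntegral (fun ξ => (ξ i * f ξ) • resolventProduct a ξ) 0 (fun _ => R) =
      a i * torusIntegral (fun ξ => f ξ • resolventProduct a ξ) 0 (fun _ => R) := by
  have hmul : TorusIntegrable (fun ξ => (ξ i * f ξ) • resolventProduct a ξ) 0 (fun _ => R) :=
    torusIntegrable_smul_resolventProduct hR₀ hR ha ((by fun_prop : Continuous fun ξ : Fin d → ℂ =>
      ξ i).continuousOn.mul hf.continuousOn)
  have hint := torusIntegrable_smul_resolventProduct hR₀ hR ha hf.continuousOn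
  have hleft : TorusIntegrable (fun ξ => a i * f ξ • resolventProduct a ξ) 0 (fun _ => R) :=
    (ContinuousLinearMap.mul ℂ 𝔸 (a i)).integrable_comp hint
  have h := torusIntegral_smul_sub_mul_resolventProduct hR₀ hR ha hcomm hf i
  have hpull := torusIntegral_clm_apply (ContinuousLinearMap.mul ℂ 𝔸 (a i)) hint
  simp only [ContinuousLinearMap.mul_apply'] at hpull
  rw [← hpull, ← sub_eq_zero, ← torusIntegral_sub hmul hleft, ← h]
  refine congrArg (torusIntegral · 0 _) (funext fun ξ => ?_)
  simp only [sub_mul, ← Algebra.smul_def, smul_sub, smul_smul, mul_smul_comm, mul_comm (ξ i)]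

end Resolvent

section Node

open scoped Matrix.Norms.L2Operator

variable {d m : ℕ} {M : Fin d → Matrix (Fin m) (Fin m) ℂ}

theorem IsNode.evalRadius_pos (hM : IsNode M) : 0 < evalRadius M := by
  have := hM.sSup_lt_one
  unfold evalRadius
  linarith

theorem IsNode.evalRadius_lt_one (hM : IsNode M) : evalRadius M < 1 := by
  have := hM.sSup_lt_one
  unfold evalRadius
  linarith

theorem IsNode.spectrum_subset_ball (hM : IsNode M) (i : Fin d) :
    spectrum ℂ (M i) ⊆ ball 0 (evalRadius M) := by
  intro c hc
  have hdet : (c • (1 : Matrix (Fin m) (Fin m) ℂ) - M i).det = 0 := by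
    simpa [spectrum.mem_iff, Matrix.isUnit_iff_isUnit_det, Algebra.algebraMap_eq_smul_one] using hc
  obtain ⟨lam, hlam, rfl⟩ := exists_mem_jointSpectrum hM.commute i c hdet
  have hle : ‖lam‖ ≤ sSup (norm '' jointSpectrum M) :=
    le_csSup ((finite_jointSpectrum M).image norm).bddAbove ⟨lam, hlam, rfl⟩
  have hcoord := norm_le_pi_norm lam i
  have hlt := hM.sSup_lt_one.2
  rw [mem_ball_zero_iff, evalRadius]
  linarith

theorem IsNode.tendsto_pow (hM : IsNode M) (i : Fin d) :
    Tendsto (fun n => M i ^ n) atTop (𝓝 0) :=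
  tendsto_pow_of_spectrum_subset_ball <|
    (hM.spectrum_subset_ball i).trans (ball_subset_ball hM.evalRadius_lt_one.le)

theorem resolventProd_eq_resolventProduct : resolventProd M = resolventProduct M := by
  ext1 ξ
  simp only [resolventProd, resolventProduct, resolvent, Matrix.nonsing_inv_eq_ringInverse,
    Algebra.algebraMap_eq_smul_one]

theorem IsNode.torusIntegrable (hM : IsNode M) {f : (Fin d → ℂ) → ℂ}
    (hf : ContinuousOn f (polydisc d)) :
    TorusIntegrable (fun ξ => f ξ • resolventProduct M ξ) 0 (fun _ => evalRadius M) :=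
  torusIntegrable_smul_resolventProduct hM.evalRadius_pos.le hM.evalRadius_lt_one
    hM.spectrum_subset_ball hf

theorem IsNode.matEval_eq (hM : IsNode M) {f : (Fin d → ℂ) → ℂ}
    (hf : ContinuousOn f (polydisc d)) :
    matEval f M = ((2 * π * Complex.I) ^ d : ℂ)⁻¹ •
      torusIntegral (fun ξ => f ξ • resolventProduct M ξ) 0 (fun _ => evalRadius M) := by
  ext a b
  have h := torusIntegral_clm_apply
    (LinearMap.toContinuousLinearMap (Matrix.entryLinearMap ℂ ℂ a b)) (hM.torusIntegrable hf)
  simp only [LinearMap.coe_toContinuousLinearMap', Matrix.entryLinearMap_apply,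
    Matrix.smul_apply, smul_eq_mul] at h
  rw [Matrix.smul_apply, ← h, matEval, Matrix.of_apply, smul_eq_mul,
    resolventProd_eq_resolventProduct]

theorem IsNode.matEval_congr (hM : IsNode M) {f g : (Fin d → ℂ) → ℂ}
    (h : Set.EqOn f g (polydisc d)) : matEval f M = matEval g M := by
  ext a b
  simp only [matEval, Matrix.of_apply]
  congr 1
  exact torusIntegral_congr hM.evalRadius_pos.le fun ξ hξ => by
    rw [h (mem_polydisc_of_norm_eq hM.evalRadius_lt_one hξ)]

theorem IsNode.matEval_add (hM : IsNode M) {f g : (Fin d → ℂ) → ℂ}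
    (hf : ContinuousOn f (polydisc d)) (hg : ContinuousOn g (polydisc d)) :
    matEval (fun z => f z + g z) M = matEval f M + matEval g M := by
  rw [hM.matEval_eq hf, hM.matEval_eq hg, hM.matEval_eq (hf.fun_add hg), ← smul_add,
    ← torusIntegral_add (hM.torusIntegrable hf) (hM.torusIntegrable hg)]
  simp only [add_smul]

theorem matEval_const_mul (c : ℂ) (f : (Fin d → ℂ) → ℂ) :
    matEval (fun z => c * f z) M = c • matEval f M := by
  ext a b
  simp only [matEval, Matrix.of_apply, Matrix.smul_apply, mul_assoc, torusIntegral_const_mul,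
    smul_eq_mul]
  ring

theorem IsNode.matEval_sum (hM : IsNode M) {κ : Type*} (s : Finset κ)
    {f : κ → (Fin d → ℂ) → ℂ} (hf : ∀ t, ContinuousOn (f t) (polydisc d)) :
    matEval (fun z => ∑ t ∈ s, f t z) M = ∑ t ∈ s, matEval (f t) M := by
  classical
  induction s using Finset.induction_on with
  | empty => simpa using matEval_const_mul (M := M) 0 0
  | insert t s ht ih =>
    simp only [Finset.sum_insert ht]
    rw [hM.matEval_add (hf t) (continuousOn_finsetSum s fun t _ => hf t), ih]

theorem IsNode.matEval_one (hM : IsNode M) : matEval (fun _ => 1) M = 1 := by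
  have hc : ((2 * π * Complex.I) ^ d : ℂ) ≠ 0 := pow_ne_zero d Complex.two_pi_I_ne_zero
  rw [hM.matEval_eq continuousOn_const]
  simp only [one_smul]
  rw [torusIntegral_resolventProduct hM.evalRadius_pos hM.spectrum_subset_ball, inv_smul_smul₀ hc]

theorem IsNode.matEval_coord_mul (hM : IsNode M) {f : (Fin d → ℂ) → ℂ}
    (hf : DifferentiableOn ℂ f (polydisc d)) (i : Fin d) :
    matEval (fun z => z i * f z) M = M i * matEval f M := by
  rw [hM.matEval_eq hf.continuousOn, hM.matEval_eq ((continuous_apply i).continuousOn.fun_mul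
    hf.continuousOn), torusIntegral_coord_mul_smul_resolventProduct hM.evalRadius_pos.le
    hM.evalRadius_lt_one hM.spectrum_subset_ball hM.commute hf, mul_smul_comm]

theorem IsNode.commute_matEval (hM : IsNode M) {f : (Fin d → ℂ) → ℂ}
    (hf : ContinuousOn f (polydisc d)) (i : Fin d) : Commute (M i) (matEval f M) := by
  have hleft := torusIntegral_clm_apply (ContinuousLinearMap.mul ℂ _ (M i)) (hM.torusIntegrable hf)
  have hright := torusIntegral_clm_apply ((ContinuousLinearMap.mul ℂ _).flip (M i))
    (hM.torusIntegrable hf)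
  simp only [ContinuousLinearMap.mul_apply', ContinuousLinearMap.flip_apply] at hleft hright
  rw [hM.matEval_eq hf]
  refine Commute.smul_right ?_ _
  rw [commute_iff_eq, ← hleft, ← hright]
  simp only [mul_smul_comm, smul_mul_assoc, (commute_resolventProduct (hM.commute i) _).eq]

end Node

/-! ### Stein inequalities and cone duality -/

section Lyapunov

variable {A : Type*}

/-- The truncation `∑ k < n, x*ᵏ p xᵏ` of the solution `h` of the Stein equation
`h - x* h x = p`. -/
def steinSum [Ring A] [StarRing A] (x : A) (n : ℕ) (p : A) : A :=
  ∑ k ∈ Finset.range n, star (x ^ k) * p * x ^ k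

theorem steinSum_sub_star_mul_steinSum_mul [Ring A] [StarRing A] (x : A) (n : ℕ) (p : A) :
    steinSum x n p - star x * steinSum x n p * x = p - star (x ^ n) * p * x ^ n := by
  have htelescope := Finset.sum_range_sub' (fun k => star (x ^ k) * p * x ^ k) n
  simp only [pow_zero, star_one, one_mul, mul_one] at htelescope
  rw [← htelescope]
  simp only [steinSum, Finset.mul_sum, Finset.sum_mul, ← Finset.sum_sub_distrib, pow_succ,
    star_mul, mul_assoc]

theorem steinSum_sub_of_commute [Ring A] [StarRing A] {x y : A} (h : Commute x y) (n : ℕ) (p : A) :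
    steinSum x n p - star y * steinSum x n p * y = steinSum x n (p - star y * p * y) := by
  simp only [steinSum, Finset.mul_sum, Finset.sum_mul, ← Finset.sum_sub_distrib]
  refine Finset.sum_congr rfl fun k _ => ?_
  have hright : x ^ k * y = y * x ^ k := (h.pow_left k).eq
  have hleft : star y * star (x ^ k) = star (x ^ k) * star y := by
    rw [← star_mul, ← star_mul, hright]
  calc star (x ^ k) * p * x ^ k - star y * (star (x ^ k) * p * x ^ k) * y
      = star (x ^ k) * p * x ^ k - (star y * star (x ^ k)) * p * (x ^ k * y) := by noncomm_ring
    _ = star (x ^ k) * (p - star y * p * y) * x ^ k := by rw [hleft, hright]; noncomm_ring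

variable [CStarAlgebra A] [PartialOrder A] [StarOrderedRing A]

theorem le_steinSum (x : A) {n : ℕ} (hn : 0 < n) {p : A} (hp : 0 ≤ p) : p ≤ steinSum x n p := by
  simpa [steinSum] using Finset.single_le_sum (f := fun k => star (x ^ k) * p * x ^ k)
    (fun k _ => star_left_conjugate_nonneg hp _) (Finset.mem_range.mpr hn)

theorem exists_lt_star_pow_mul_mul_pow_le_one {x : A} (hx : Tendsto (fun n => x ^ n) atTop (𝓝 0))
    {p : A} (hp : 0 ≤ p) : ∃ n, 0 < n ∧ star (x ^ n) * p * x ^ n ≤ 1 := by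
  have hlim : Tendsto (fun n => ‖star (x ^ n) * p * x ^ n‖) atTop (𝓝 0) := by
    simpa using ((hx.star.mul_const p).mul hx).norm
  obtain ⟨n, hn, hn0⟩ := ((hlim.eventually_le_const one_pos).and (eventually_gt_atTop 0)).exists
  exact ⟨n, hn0, (CStarAlgebra.norm_le_one_iff_of_nonneg _ (star_left_conjugate_nonneg hp _)).mp hn⟩

theorem exists_one_le_sub_star_mul_mul {σ : Type*} {x : σ → A} (hcomm : ∀ i j, Commute (x i) (x j))
    (hpow : ∀ i, Tendsto (fun n => x i ^ n) atTop (𝓝 0)) (s : Finset σ) :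
    ∃ g : A, 1 ≤ g ∧ ∀ i ∈ s, 1 ≤ g - star (x i) * g * x i := by
  classical
  induction s using Finset.induction_on with
  | empty => exact ⟨1, le_rfl, by simp⟩
  | insert j s _ ih =>
    obtain ⟨g, hg, hgs⟩ := ih
    -- doubling `g` leaves room for the term `x*ⁿ g xⁿ` that telescoping leaves over
    have hg2 : 1 + 1 ≤ g + g := add_le_add hg hg
    have hone : (1 : A) ≤ 1 + 1 := le_add_of_nonneg_left zero_le_one
    have hpos : 0 ≤ g + g := zero_le_one.trans (hone.trans hg2)
    obtain ⟨n, hn, hle⟩ := exists_lt_star_pow_mul_mul_pow_le_one (hpow j) hpos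
    refine ⟨steinSum (x j) n (g + g), hone.trans (hg2.trans (le_steinSum _ hn hpos)), ?_⟩
    intro i hi
    rcases Finset.mem_insert.mp hi with rfl | hi
    · rw [steinSum_sub_star_mul_steinSum_mul]
      exact le_sub_iff_add_le.mpr ((add_le_add_right hle 1).trans hg2)
    · rw [steinSum_sub_of_commute (hcomm j i)]
      have hstep : 1 + 1 ≤ (g + g) - star (x i) * (g + g) * x i := by
        convert add_le_add (hgs i hi) (hgs i hi) using 1
        noncomm_ring
      exact (hone.trans hstep).trans (le_steinSum _ hn (zero_le_one.trans (hone.trans hstep)))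

end Lyapunov

section ConeDuality

theorem isClosed_image_of_norm_le {E F : Type*} [NormedAddCommGroup E] [ProperSpace E]
    [TopologicalSpace F] [T2Space F] [FirstCountableTopology F] {f : E → F} (hf : Continuous f)
    {q : F → ℝ} (hq : Continuous q) {s : Set E} (hs : IsClosed s)
    (h : ∀ x ∈ s, ‖x‖ ≤ q (f x)) : IsClosed (f '' s) := by
  refine IsSeqClosed.isClosed fun u y hu hy => ?_
  choose x hxs hxu using hu
  obtain rfl : (fun n => f (x n)) = u := funext hxu
  obtain ⟨c, hc⟩ := ((hq.tendsto y).comp hy).bddAbove_range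
  obtain ⟨a, -, r, hr, ha⟩ := tendsto_subseq_of_bounded (isBounded_closedBall (x := (0 : E)))
    fun n => mem_closedBall_zero_iff.mpr ((h _ (hxs n)).trans (hc ⟨n, rfl⟩))
  exact ⟨a, hs.mem_of_tendsto ha (.of_forall fun n => hxs _),
    tendsto_nhds_unique ((hf.tendsto a).comp ha) (hy.comp hr.tendsto_atTop)⟩

theorem mem_image_properCone_of_forall_nonneg {E F : Type*} [NormedAddCommGroup E]
    [NormedSpace ℝ E] [ProperSpace E] [NormedAddCommGroup F] [NormedSpace ℝ F]
    (K : ProperCone ℝ E) (f : E →L[ℝ] F) {q : F → ℝ} (hq : Continuous q)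
    (hK : ∀ x ∈ K, ‖x‖ ≤ q (f x)) {b : F}
    (hb : ∀ g : StrongDual ℝ F, (∀ x ∈ K, 0 ≤ g (f x)) → 0 ≤ g b) : ∃ x ∈ K, f x = b := by
  have hclosed : IsClosed (f '' K) := isClosed_image_of_norm_le f.continuous hq K.isClosed hK
  by_contra hne
  have hmem : b ∉ K.map f := by
    rw [ProperCone.mem_map, PointedCone.mem_closure]
    exact fun h => hne (hclosed.closure_subset h)
  obtain ⟨g, hg, hgb⟩ := (K.map f).hyperplane_separation_point hmem
  exact hgb.not_ge (hb g fun x hx => hg _ (subset_closure ⟨x, hx, rfl⟩))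

end ConeDuality

section Stein

open scoped MatrixOrder ComplexOrder Matrix.Norms.L2Operator

variable {ι τ : Type*} [Fintype ι]

theorem exists_isHermitian_forall_eq_re_trace_mul (f : Matrix ι ι ℂ →ₗ[ℝ] ℝ) :
    ∃ H : Matrix ι ι ℂ, H.IsHermitian ∧
      ∀ M : Matrix ι ι ℂ, M.IsHermitian → f M = (H * M).trace.re := by
  classical
  let F : Matrix ι ι ℂ →ₗ[ℂ] ℂ := Module.Dual.extendRCLike f
  let G : Matrix ι ι ℂ := .of fun b a => F (.single a b 1)
  have hG : ∀ M, (G * M).trace = F M := fun M => by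
    conv_rhs => rw [M.matrix_eq_sum_single]
    simp only [map_sum, Matrix.trace, Matrix.diag, Matrix.mul_apply]
    rw [Finset.sum_comm]
    refine Finset.sum_congr rfl fun a _ => Finset.sum_congr rfl fun b _ => ?_
    have hsingle : Matrix.single a b (M a b) = M a b • Matrix.single a b 1 := by simp
    rw [hsingle, map_smul, smul_eq_mul, mul_comm]
    rfl
  have hF : ∀ M, (F M).re = f M := fun M => by
    simp [F, Module.Dual.extendRCLike_apply]
  refine ⟨((1 / 2 : ℝ) : ℂ) • (G + Gᴴ), ?_, fun M hM => ?_⟩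
  · simp [Matrix.IsHermitian, Matrix.conjTranspose_smul, add_comm]
  · have hstar : (Gᴴ * M).trace = star (F M) := by
      rw [← hG, ← Matrix.trace_conjTranspose, Matrix.conjTranspose_mul, hM.eq,
        Matrix.trace_mul_comm]
    rw [Matrix.smul_mul, Matrix.trace_smul, Matrix.add_mul, Matrix.trace_add, hstar, hG,
      smul_eq_mul, Complex.re_ofReal_mul, Complex.add_re, Complex.star_def, Complex.conj_re, hF]
    ring

theorem trace_mul_sub_mul_mul_conjTranspose (X H Γ : Matrix ι ι ℂ) :
    (H * (Γ - X * Γ * Xᴴ)).trace = ((H - Xᴴ * H * X) * Γ).trace := by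
  have hcycle : (H * (X * Γ * Xᴴ)).trace = (Xᴴ * H * X * Γ).trace := by
    rw [← Matrix.mul_assoc, Matrix.trace_mul_comm]
    simp only [Matrix.mul_assoc]
  rw [Matrix.mul_sub, Matrix.sub_mul, Matrix.trace_sub, Matrix.trace_sub, hcycle]

/-- The adjoint Stein map `Γ ↦ ∑ t, (Γ t - X t Γ t X t*)`; it is dual to the Lyapunov
inequalities `X t* H X t ≤ H` under the trace pairing. -/
def steinMap [Fintype τ] (X : τ → Matrix ι ι ℂ) : (τ → Matrix ι ι ℂ) →ₗ[ℝ] Matrix ι ι ℂ where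
  toFun Γ := ∑ t, (Γ t - X t * Γ t * (X t)ᴴ)
  map_add' Γ Γ' := by
    simp only [Pi.add_apply, Matrix.mul_add, Matrix.add_mul, ← Finset.sum_add_distrib]
    exact Finset.sum_congr rfl fun t _ => by abel
  map_smul' c Γ := by
    simp only [Pi.smul_apply, Matrix.mul_smul, Matrix.smul_mul, ← smul_sub, Finset.smul_sum,
      RingHom.id_apply]

theorem trace_mul_steinMap [Fintype τ] (X : τ → Matrix ι ι ℂ) (H : Matrix ι ι ℂ)
    (Γ : τ → Matrix ι ι ℂ) :
    (H * steinMap X Γ).trace = ∑ t, ((H - (X t)ᴴ * H * X t) * Γ t).trace := by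
  simp only [steinMap, LinearMap.coe_mk, AddHom.coe_mk, Finset.mul_sum, Matrix.trace_sum,
    trace_mul_sub_mul_mul_conjTranspose]

theorem steinMap_single [Fintype τ] [DecidableEq τ] (X : τ → Matrix ι ι ℂ) (t : τ)
    (P : Matrix ι ι ℂ) : steinMap X (Pi.single t P) = P - X t * P * (X t)ᴴ := by
  rw [steinMap, LinearMap.coe_mk, AddHom.coe_mk,
    Finset.sum_eq_single t (fun _ _ h => by simp [Pi.single_eq_of_ne h]) (by simp),
    Pi.single_eq_same]

theorem re_trace_mul_nonneg {P Q : Matrix ι ι ℂ} (hP : 0 ≤ P) (hQ : 0 ≤ Q) :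
    0 ≤ (P * Q).trace.re := by
  classical
  obtain ⟨B, rfl⟩ := CStarAlgebra.nonneg_iff_eq_star_mul_self.mp hP
  rw [Matrix.mul_assoc, Matrix.trace_mul_comm]
  have hconj := (Matrix.nonneg_iff_posSemidef.mp hQ).mul_mul_conjTranspose_same B
  exact (Complex.le_def.mp hconj.trace_nonneg).1

theorem nonneg_of_forall_re_trace_mul_vecMulVec {H : Matrix ι ι ℂ} (hH : H.IsHermitian)
    (h : ∀ v : ι → ℂ, 0 ≤ (H * Matrix.vecMulVec v (star v)).trace.re) : 0 ≤ H := by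
  refine (Matrix.PosSemidef.of_dotProduct_mulVec_nonneg hH fun v => ?_).nonneg
  have hre := h v
  rw [Matrix.mul_vecMulVec, Matrix.trace_vecMulVec, dotProduct_comm] at hre
  exact Complex.le_def.mpr ⟨hre, by simpa using (hH.im_star_dotProduct_mulVec_self v).symm⟩

variable [DecidableEq ι]

theorem norm_le_re_trace {P : Matrix ι ι ℂ} (hP : 0 ≤ P) : ‖P‖ ≤ P.trace.re := by
  have hpos := Matrix.nonneg_iff_posSemidef.mp hP
  rcases subsingleton_or_nontrivial (Matrix ι ι ℂ) with _ | _
  · simp [Subsingleton.elim P 0]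
  have hmem := CStarAlgebra.norm_mem_spectrum_of_nonneg hP
  rw [hpos.isHermitian.spectrum_real_eq_range_eigenvalues] at hmem
  obtain ⟨i, hi⟩ := hmem
  rw [← hi, hpos.isHermitian.trace_eq_sum_eigenvalues, Complex.re_sum]
  exact Finset.single_le_sum (f := hpos.isHermitian.eigenvalues)
    (fun i _ => hpos.eigenvalues_nonneg i) (Finset.mem_univ i)

theorem norm_le_re_trace_mul_steinMap [Fintype τ] {X : τ → Matrix ι ι ℂ} {H : Matrix ι ι ℂ}
    (hH : ∀ t, 1 ≤ H - (X t)ᴴ * H * X t) {Γ : τ → Matrix ι ι ℂ} (hΓ : 0 ≤ Γ) :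
    ‖Γ‖ ≤ (H * steinMap X Γ).trace.re := by
  have hterm : ∀ t, ‖Γ t‖ ≤ ((H - (X t)ᴴ * H * X t) * Γ t).trace.re := fun t => by
    have h := re_trace_mul_nonneg (sub_nonneg.mpr (hH t)) (hΓ t)
    rw [Matrix.sub_mul, Matrix.one_mul, Matrix.trace_sub, Complex.sub_re] at h
    exact (norm_le_re_trace (hΓ t)).trans (sub_nonneg.mp h)
  rw [trace_mul_steinMap, Complex.re_sum]
  refine (pi_norm_le_iff_of_nonneg (Finset.sum_nonneg fun t _ =>
    (norm_nonneg _).trans (hterm t))).mpr fun t => (hterm t).trans ?_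
  exact Finset.single_le_sum (fun t _ => (norm_nonneg _).trans (hterm t)) (Finset.mem_univ t)

theorem exists_nonneg_steinMap_eq [Fintype τ] {X : τ → Matrix ι ι ℂ} {H₀ T : Matrix ι ι ℂ}
    (hH₀ : ∀ t, 1 ≤ H₀ - (X t)ᴴ * H₀ * X t) (hT : T.IsHermitian)
    (h : ∀ H : Matrix ι ι ℂ, (∀ t, 0 ≤ H - (X t)ᴴ * H * X t) → 0 ≤ (H * T).trace.re) :
    ∃ Γ : τ → Matrix ι ι ℂ, 0 ≤ Γ ∧ steinMap X Γ = T := by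
  classical
  have hproper : ProperSpace (τ → Matrix ι ι ℂ) := FiniteDimensional.proper ℂ _
  refine mem_image_properCone_of_forall_nonneg (ProperCone.positive ℝ (τ → Matrix ι ι ℂ))
    (LinearMap.toContinuousLinearMap (steinMap X)) (q := fun M => (H₀ * M).trace.re)
    (Complex.continuous_re.comp (by fun_prop))
    (fun Γ hΓ => norm_le_re_trace_mul_steinMap hH₀ hΓ) fun g hg => ?_
  obtain ⟨H, hH, hgH⟩ := exists_isHermitian_forall_eq_re_trace_mul (g : Matrix ι ι ℂ →ₗ[ℝ] ℝ)
  rw [ContinuousLinearMap.coe_coe] at hgH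
  rw [hgH T hT]
  refine h H fun t => nonneg_of_forall_re_trace_mul_vecMulVec
    (hH.sub (Matrix.isHermitian_conjTranspose_mul_mul _ hH)) fun v => ?_
  have hv := Matrix.posSemidef_vecMulVec_self_star v
  have hstein : (steinMap X (Pi.single t (Matrix.vecMulVec v (star v)))).IsHermitian := by
    rw [steinMap_single]
    exact hv.isHermitian.sub (Matrix.isHermitian_mul_mul_conjTranspose _ hv.isHermitian)
  have hnonneg := hg _ (Pi.single_nonneg.mpr hv.nonneg : 0 ≤ Pi.single t _)
  rw [LinearMap.coe_toContinuousLinearMap', hgH _ hstein, steinMap_single] at hnonneg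
  rwa [← trace_mul_sub_mul_mul_conjTranspose]

end Stein

/-! ### Contractive realizations -/

section Contraction

open scoped MatrixOrder ComplexOrder

variable {κ : Type*} [Fintype κ]

theorem exists_continuousLinearMap_apply_eq_of_norm_le {𝕜 V E F : Type*} [RCLike 𝕜]
    [AddCommGroup V] [Module 𝕜 V] [NormedAddCommGroup E] [InnerProductSpace 𝕜 E] [CompleteSpace E]
    [NormedAddCommGroup F] [NormedSpace 𝕜 F] [CompleteSpace F] (P : V →ₗ[𝕜] E) (Q : V →ₗ[𝕜] F)
    (h : ∀ v, ‖Q v‖ ≤ ‖P v‖) : ∃ U : E →L[𝕜] F, ‖U‖ ≤ 1 ∧ ∀ v, U (P v) = Q v := by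
  let S := (LinearMap.range P).topologicalClosure
  have hS : ∀ v, P v ∈ S := fun v => Submodule.le_topologicalClosure _ ⟨v, rfl⟩
  let e : V →ₗ[𝕜] S := P.codRestrict S hS
  have hdense : DenseRange e := by
    refine Subtype.dense_iff.mpr ?_
    rw [← Set.range_comp]
    exact subset_rfl
  have hbound : ∀ v, ‖Q v‖ ≤ 1 * ‖e v‖ := fun v => (h v).trans_eq (one_mul _).symm
  refine ⟨(Q.extendOfNorm e).comp S.orthogonalProjectionOnto, ?_, fun v => ?_⟩
  · exact (ContinuousLinearMap.opNorm_comp_le _ _).trans (mul_le_one₀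
      (LinearMap.opNorm_extendOfNorm_le hdense zero_le_one hbound) (norm_nonneg _)
      S.orthogonalProjectionOnto_norm_le)
  · rw [ContinuousLinearMap.comp_apply,
      show S.orthogonalProjectionOnto (P v) = e v from
        Subtype.ext (S.starProjection_eq_self_iff.mpr (hS v)),
      LinearMap.extendOfNorm_eq hdense ⟨1, hbound⟩]

theorem star_dotProduct_self (x : κ → ℂ) : star x ⬝ᵥ x = ((∑ s, ‖x s‖ ^ 2 : ℝ) : ℂ) := by
  simp [dotProduct, Complex.conj_mul']

theorem conjTranspose_mul_self_le_one [DecidableEq κ] {U : Matrix κ κ ℂ}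
    (h : ∀ x : κ → ℂ, ∑ s, ‖(U *ᵥ x) s‖ ^ 2 ≤ ∑ s, ‖x s‖ ^ 2) : Uᴴ * U ≤ 1 := by
  rw [Matrix.le_iff]
  refine .of_dotProduct_mulVec_nonneg
    (Matrix.isHermitian_one.sub (Matrix.isHermitian_conjTranspose_mul_self U)) fun x => ?_
  rw [Matrix.sub_mulVec, Matrix.one_mulVec, dotProduct_sub, ← Matrix.mulVec_mulVec,
    Matrix.dotProduct_mulVec, ← Matrix.star_mulVec, star_dotProduct_self, star_dotProduct_self,
    ← Complex.ofReal_sub, Complex.zero_le_real]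
  exact sub_nonneg.mpr (h x)

theorem exists_contractive_matrix_mulVec_eq [DecidableEq κ] {V : Type*} [AddCommGroup V]
    [Module ℂ V] (P Q : V →ₗ[ℂ] κ → ℂ) (h : ∀ v, ∑ s, ‖Q v s‖ ^ 2 ≤ ∑ s, ‖P v s‖ ^ 2) :
    ∃ U : Matrix κ κ ℂ, Uᴴ * U ≤ 1 ∧ ∀ v, U *ᵥ P v = Q v := by
  let e := (WithLp.linearEquiv 2 ℂ (κ → ℂ)).symm
  have he : ∀ x : κ → ℂ, ‖e x‖ ^ 2 = ∑ s, ‖x s‖ ^ 2 := fun x => by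
    simp [e, EuclideanSpace.norm_sq_eq]
  obtain ⟨T, hT, hTPQ⟩ := exists_continuousLinearMap_apply_eq_of_norm_le (e.toLinearMap ∘ₗ P)
    (e.toLinearMap ∘ₗ Q) fun v => le_of_sq_le_sq (by simpa [he] using h v) (norm_nonneg _)
  let U : Matrix κ κ ℂ :=
    LinearMap.toMatrix' (e.symm.toLinearMap ∘ₗ T.toLinearMap ∘ₗ e.toLinearMap)
  have hU : ∀ x, U *ᵥ x = e.symm (T (e x)) := fun x => by
    rw [← Matrix.toLin'_apply, Matrix.toLin'_toMatrix']; rfl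
  refine ⟨U, conjTranspose_mul_self_le_one fun x => ?_, fun v => ?_⟩
  · rw [← he, ← he, hU, e.apply_symm_apply]
    exact pow_le_pow_left₀ (norm_nonneg _) (by simpa using T.le_of_opNorm_le hT (e x)) 2
  · rw [hU]
    exact (LinearEquiv.symm_apply_eq _).mpr (hTPQ v)

theorem sum_norm_sq_sum_smul {E : Type*} [NormedAddCommGroup E] [InnerProductSpace ℂ E]
    (V : Matrix κ κ ℂ) (x : κ → E) :
    ((∑ s, ‖∑ t, V s t • x t‖ ^ 2 : ℝ) : ℂ) =
      ∑ t, ∑ t', (Vᴴ * V) t t' * inner ℂ (x t) (x t') := by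
  have hrow : ∀ s, (‖∑ t, V s t • x t‖ : ℂ) ^ 2 =
      ∑ t, ∑ t', star (V s t) * V s t' * inner ℂ (x t) (x t') := fun s => by
    refine (inner_self_eq_norm_sq_to_K (𝕜 := ℂ) (∑ t, V s t • x t)).symm.trans ?_
    simp only [sum_inner, inner_smul_left]
    simp only [inner_sum, inner_smul_right, Finset.mul_sum, mul_assoc, RCLike.star_def]
  push_cast
  simp only [hrow, Matrix.mul_apply, Finset.sum_mul, Matrix.conjTranspose_apply]
  rw [Finset.sum_comm]
  exact Finset.sum_congr rfl fun t _ => Finset.sum_comm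

theorem sum_norm_sq_sum_smul_le [DecidableEq κ] {U : Matrix κ κ ℂ} (hU : Uᴴ * U ≤ 1) {E : Type*}
    [NormedAddCommGroup E] [InnerProductSpace ℂ E] (x : κ → E) :
    ∑ s, ‖∑ t, U s t • x t‖ ^ 2 ≤ ∑ t, ‖x t‖ ^ 2 := by
  obtain ⟨B, hB⟩ := CStarAlgebra.nonneg_iff_eq_star_mul_self.mp (sub_nonneg.mpr hU)
  have hdefect := sum_norm_sq_sum_smul B x
  rw [← Matrix.star_eq_conjTranspose, ← hB] at hdefect
  have hone := sum_norm_sq_sum_smul 1 x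
  simp only [Matrix.conjTranspose_one, Matrix.mul_one] at hone
  simp only [Matrix.sub_apply, sub_mul, Finset.sum_sub_distrib] at hdefect
  rw [← hone, ← sum_norm_sq_sum_smul U x, ← Complex.ofReal_sub, Complex.ofReal_inj] at hdefect
  have hid : ∀ s, ∑ t, (1 : Matrix κ κ ℂ) s t • x t = x s := fun s => by simp [Matrix.one_apply]
  simp only [hid] at hdefect
  exact sub_nonneg.mp (hdefect ▸ Finset.sum_nonneg fun s _ => sq_nonneg _)

theorem conjTranspose_mul_self_map_conj_le_one [DecidableEq κ] {U : Matrix κ κ ℂ}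
    (hU : Uᴴ * U ≤ 1) : (U.map conj)ᴴ * U.map conj ≤ 1 := by
  have hconj : (U.map conj)ᴴ * U.map conj = (Uᴴ * U)ᵀ := by
    rw [Matrix.transpose_mul]
    congr 1
    ext
    simp
  rw [Matrix.le_iff] at hU ⊢
  simpa only [Matrix.transpose_sub, Matrix.transpose_one, ← hconj] using hU.transpose

end Contraction

section Realization

open scoped MatrixOrder ComplexOrder

variable {ι κ σ : Type*} [Fintype ι] [Fintype κ] [Fintype σ]

theorem dotProduct_vecMulVec_star_mulVec_star (w v : ι → ℂ) :
    v ⬝ᵥ (Matrix.vecMulVec w (star w) *ᵥ star v) = ((‖v ⬝ᵥ w‖ ^ 2 : ℝ) : ℂ) := by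
  rw [Matrix.vecMulVec_mulVec, op_smul_eq_smul, dotProduct_smul, smul_eq_mul,
    Complex.ofReal_pow, ← Complex.conj_mul']
  simp [dotProduct, mul_comm]

theorem mul_vecMulVec_star_mul_conjTranspose (X : Matrix ι ι ℂ) (w : ι → ℂ) :
    X * Matrix.vecMulVec w (star w) * Xᴴ = Matrix.vecMulVec (X *ᵥ w) (star (X *ᵥ w)) := by
  rw [Matrix.mul_vecMulVec, Matrix.vecMulVec_mul, Matrix.star_mulVec]

theorem exists_eq_sum_vecMulVec_star {P : Matrix ι ι ℂ} (hP : 0 ≤ P) :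
    ∃ g : ι → ι → ℂ, P = ∑ l, Matrix.vecMulVec (g l) (star (g l)) := by
  classical
  obtain ⟨B, rfl⟩ := CStarAlgebra.nonneg_iff_eq_star_mul_self.mp hP
  refine ⟨fun l => star (B l), ?_⟩
  ext a b
  simp [Matrix.mul_apply, Matrix.sum_apply, Matrix.vecMulVec_apply]

theorem exists_contractive_of_sum_vecMulVec_star_le {ι : Type*} [Finite ι] [DecidableEq κ]
    (p q : κ → ι → ℂ)
    (h : ∑ s, Matrix.vecMulVec (q s) (star (q s)) ≤ ∑ s, Matrix.vecMulVec (p s) (star (p s))) :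
    ∃ U : Matrix κ κ ℂ, Uᴴ * U ≤ 1 ∧ ∀ s, q s = ∑ t, U s t • p t := by
  classical
  have := Fintype.ofFinite ι
  let pair (w : κ → ι → ℂ) : (ι → ℂ) →ₗ[ℂ] κ → ℂ :=
    { toFun := fun v s => v ⬝ᵥ w s
      map_add' := fun v v' => by ext; simp [add_dotProduct]
      map_smul' := fun c v => by ext; simp [smul_dotProduct] }
  obtain ⟨U, hU, hUpq⟩ := exists_contractive_matrix_mulVec_eq (pair p) (pair q) fun v => by
    have hv := (Matrix.le_iff.mp h).dotProduct_mulVec_nonneg (star v)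
    simp only [Matrix.sub_mulVec, Matrix.sum_mulVec, dotProduct_sub, dotProduct_sum, star_star,
      dotProduct_vecMulVec_star_mulVec_star] at hv
    rw [← Complex.ofReal_sum, ← Complex.ofReal_sum, ← Complex.ofReal_sub,
      Complex.zero_le_real] at hv
    exact sub_nonneg.mp hv
  refine ⟨U, hU, fun s => funext fun a => ?_⟩
  have hentry := congrFun (hUpq (Pi.single a 1)) s
  simp only [pair, LinearMap.coe_mk, AddHom.coe_mk, single_one_dotProduct] at hentry
  simpa [pair, Matrix.mulVec, dotProduct] using hentry.symm

theorem re_trace_mul_smul_vecMulVec_sub (H : Matrix ι ι ℂ) (c : ℝ) (e β : ι → ℂ) :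
    (H * ((c : ℂ) • Matrix.vecMulVec e (star e) - Matrix.vecMulVec β (star β))).trace.re =
      c * (star e ⬝ᵥ (H *ᵥ e)).re - (star β ⬝ᵥ (H *ᵥ β)).re := by
  simp only [Matrix.mul_sub, Matrix.mul_smul, Matrix.trace_sub, Matrix.trace_smul,
    Matrix.mul_vecMulVec, Matrix.trace_vecMulVec, dotProduct_comm _ (star _), Complex.sub_re,
    smul_eq_mul, Complex.re_ofReal_mul]

theorem exists_nonneg_add_sum_le [DecidableEq ι] {X : σ → Matrix ι ι ℂ}
    (hcomm : ∀ i j, Commute (X i) (X j)) (hpow : ∀ i, Tendsto (fun n => X i ^ n) atTop (𝓝 0))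
    {e β : ι → ℂ} {c : ℝ} (h : ∀ H : Matrix ι ι ℂ, 0 ≤ H → (∀ i, (X i)ᴴ * H * X i ≤ H) →
      (star β ⬝ᵥ (H *ᵥ β)).re ≤ c * (star e ⬝ᵥ (H *ᵥ e)).re) :
    ∃ Γ : σ → Matrix ι ι ℂ, (∀ i, 0 ≤ Γ i) ∧
      Matrix.vecMulVec β (star β) + ∑ i, Γ i ≤
        (c : ℂ) • Matrix.vecMulVec e (star e) + ∑ i, X i * Γ i * (X i)ᴴ := by
  open scoped Matrix.Norms.L2Operator in
  obtain ⟨H₀, hH₀, hH₀X⟩ := exists_one_le_sub_star_mul_mul hcomm hpow Finset.univ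
  -- the additional coordinate `none`, on which `X` vanishes, produces the slack of the inequality
  let X' : Option σ → Matrix ι ι ℂ := fun o => o.elim 0 X
  have hherm : ((c : ℂ) • Matrix.vecMulVec e (star e) -
      Matrix.vecMulVec β (star β)).IsHermitian := by
    refine Matrix.IsHermitian.sub ?_ (Matrix.posSemidef_vecMulVec_self_star β).isHermitian
    rw [Matrix.IsHermitian, Matrix.conjTranspose_smul,
      (Matrix.posSemidef_vecMulVec_self_star e).isHermitian.eq, Complex.star_def,
      Complex.conj_ofReal]
  obtain ⟨Γ, hΓ, hsum⟩ := exists_nonneg_steinMap_eq (X := X') (H₀ := H₀) (fun o => by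
    cases o with
    | none => simpa [X'] using hH₀
    | some i => exact hH₀X i (Finset.mem_univ i)) hherm fun H hH => by
      rw [re_trace_mul_smul_vecMulVec_sub]
      exact sub_nonneg.mpr (h H (by simpa [X'] using hH none) fun i => sub_nonneg.mp (hH (some i)))
  refine ⟨fun i => Γ (some i), fun i => hΓ _, ?_⟩
  simp only [steinMap, LinearMap.coe_mk, AddHom.coe_mk, Fintype.sum_option, X', Option.elim_none,
    Option.elim_some, Matrix.zero_mul, Finset.sum_sub_distrib, zero_add] at hsum
  have hslack : 0 ≤ Γ none := hΓ none
  rw [eq_sub_of_add_eq (sub_eq_iff_eq_add.mp hsum)] at hslack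
  rw [← sub_nonneg]
  convert hslack using 1
  abel

theorem exists_contractive_realization [DecidableEq ι] [DecidableEq σ] {X : σ → Matrix ι ι ℂ}
    (hcomm : ∀ i j, Commute (X i) (X j)) (hpow : ∀ i, Tendsto (fun n => X i ^ n) atTop (𝓝 0))
    {e β : ι → ℂ} {C : ℝ} (h : ∀ H : Matrix ι ι ℂ, 0 ≤ H → (∀ i, (X i)ᴴ * H * X i ≤ H) →
      (star β ⬝ᵥ (H *ᵥ β)).re ≤ C ^ 2 * (star e ⬝ᵥ (H *ᵥ e)).re) :
    ∃ (U : Matrix (Option (σ × ι)) (Option (σ × ι)) ℂ) (g : σ × ι → ι → ℂ), Uᴴ * U ≤ 1 ∧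
      β = (C * U none none) • e + ∑ t, U none (some t) • (X t.1 *ᵥ g t) ∧
      ∀ s, g s = (C * U (some s) none) • e + ∑ t, U (some s) (some t) • (X t.1 *ᵥ g t) := by
  obtain ⟨Γ, hΓ, hle⟩ := exists_nonneg_add_sum_le hcomm hpow h
  choose g hg using fun i => exists_eq_sum_vecMulVec_star (hΓ i)
  obtain ⟨U, hU, hUpq⟩ := exists_contractive_of_sum_vecMulVec_star_le
    (fun s : Option (σ × ι) => s.elim ((C : ℂ) • e) fun t => X t.1 *ᵥ g t.1 t.2)
    (fun s => s.elim β fun t => g t.1 t.2) (by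
      simp only [Fintype.sum_option, Fintype.sum_prod_type, Option.elim_none, Option.elim_some,
        ← mul_vecMulVec_star_mul_conjTranspose, ← Finset.sum_mul, ← Finset.mul_sum, ← hg]
      convert hle using 2
      rw [star_smul, Matrix.smul_vecMulVec, Matrix.vecMulVec_smul, smul_smul, Complex.star_def,
        Complex.conj_ofReal, Complex.ofReal_pow, pow_two])
  simp only [Fintype.sum_option, Option.elim_none, Option.elim_some, smul_smul,
    mul_comm (U _ none)] at hUpq
  exact ⟨U, fun t => g t.1 t.2, hU, hUpq none, fun s => hUpq (some s)⟩

end Realization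

/-! ### Construction of admissible kernels -/

section EvaluationModel

variable {E : Type*} [NormedAddCommGroup E] [InnerProductSpace ℂ E] [CompleteSpace E]

theorem exists_mem_orthogonal_iInf_ker {X F : Type*} [NormedAddCommGroup F] [NormedSpace ℂ F]
    (ev : X → E →L[ℂ] F) (a : E) :
    ∃ f ∈ (⨅ x, (ev x).ker)ᗮ, ‖f‖ ≤ ‖a‖ ∧ ∀ x, ev x f = ev x a := by
  have hclosed : IsClosed ((⨅ x, (ev x).ker : Submodule ℂ E) : Set E) := by
    rw [Submodule.coe_iInf]
    exact isClosed_iInter fun x => (ev x).isClosed_ker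
  have : CompleteSpace (⨅ x, (ev x).ker : Submodule ℂ E) := hclosed.completeSpace_coe
  set N : Submodule ℂ E := ⨅ x, (ev x).ker
  have hsub : a - Nᗮ.starProjection a ∈ N := by simp
  refine ⟨Nᗮ.starProjection a, (Nᗮ.orthogonalProjectionOnto a).2,
    Nᗮ.norm_orthogonalProjectionOnto_apply_le a, fun x => ?_⟩
  have hker : ev x (a - Nᗮ.starProjection a) = 0 := (Submodule.mem_iInf _).mp hsub x
  rw [map_sub, sub_eq_zero] at hker
  exact hker.symm

/-- The reproducing kernel Hilbert space of the functions `x ↦ ev x a`, realized on the orthogonal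
complement of the vectors that give the zero function. -/
@[reducible]
def rkhsOfEvaluations {X : Type*} (ev : X → E →L[ℂ] ℂ) : RKHS ℂ (⨅ x, (ev x).ker)ᗮ X ℂ where
  coeCLM := ContinuousLinearMap.pi fun x => (ev x).comp (⨅ x, (ev x).ker)ᗮ.subtypeL
  coeCLM_injective := by
    rw [injective_iff_map_eq_zero]
    intro a ha
    have hmem : a.1 ∈ ⨅ x, (ev x).ker := (Submodule.mem_iInf _).mpr fun x => congrFun ha x
    exact Subtype.ext (inner_self_eq_zero.mp (a.2 a.1 hmem))

end EvaluationModel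

theorem extendZero_eqOn {d : ℕ} {f : polydisc d → ℂ} {g : (Fin d → ℂ) → ℂ}
    (h : ∀ z : polydisc d, f z = g z.1) : Set.EqOn (extendZero f) g (polydisc d) := by
  intro z hz
  rw [extendZero_apply f ⟨z, hz⟩, h]

theorem exists_admissibleKernel_of_evaluations {d : ℕ} {E : Type} [NormedAddCommGroup E]
    [InnerProductSpace ℂ E] [CompleteSpace E] (ev : polydisc d → E →L[ℂ] ℂ)
    (hol : ∀ a, DifferentiableOn ℂ (extendZero fun z => ev z a) (polydisc d))
    (hmul : ∀ (i : Fin d) (a : E), ∃ b, (∀ z, ev z b = z.1 i * ev z a) ∧ ‖b‖ ≤ ‖a‖) :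
    ∃ k : AdmissibleKernel d,
      (∀ f : k.H, ∃ a : E, ‖a‖ = ‖f‖ ∧ ∀ z, f z = ev z a) ∧
      ∀ a : E, ∃ f : k.H, ‖f‖ ≤ ‖a‖ ∧ ∀ z, f z = ev z a := by
  let k : AdmissibleKernel d :=
    { H := (⨅ z, (ev z).ker : Submodule ℂ E)ᗮ
      rkhs := rkhsOfEvaluations ev
      holomorphic := fun f => hol f.1
      contraction := fun i f => by
        obtain ⟨b, hb, hbn⟩ := hmul i f.1
        obtain ⟨g, hg, hgn, hgb⟩ := exists_mem_orthogonal_iInf_ker ev b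
        exact ⟨⟨g, hg⟩, fun z => (hgb z).trans (hb z), hgn.trans hbn⟩ }
  refine ⟨k, fun f => ⟨f.1, rfl, fun z => rfl⟩, fun a => ?_⟩
  obtain ⟨f, hf, hfn, hfa⟩ := exists_mem_orthogonal_iInf_ker ev a
  exact ⟨⟨f, hf⟩, hfn, hfa⟩

section BasisShift

variable {ι 𝕜 E : Type*} [RCLike 𝕜] [NormedAddCommGroup E] [InnerProductSpace 𝕜 E]
  (b : HilbertBasis ι 𝕜 E) {τ σ : ι → ι} (hτ : τ.Injective) (hσ : σ.Injective)

theorem eq_of_forall_inner_basis_eq {x y : E} (h : ∀ α, inner 𝕜 (b α) x = inner 𝕜 (b α) y) :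
    x = y := by
  refine b.repr.injective (lp.ext (funext fun α => ?_))
  rw [b.repr_apply_apply, b.repr_apply_apply, h]

variable [CompleteSpace E]

/-- The isometry that permutes the vectors of a Hilbert basis by `b α ↦ b (τ α)`, for injective
`τ`. -/
def basisShift : E →ₗᵢ[𝕜] E :=
  ((b.orthonormal.comp τ hτ).orthogonalFamily.linearIsometry).comp b.repr.toLinearIsometry

theorem basisShift_apply (α : ι) : basisShift b hτ (b α) = b (τ α) := by
  classical
  simp only [basisShift, LinearIsometry.coe_comp, Function.comp_apply,
    LinearIsometryEquiv.coe_toLinearIsometry, b.repr_self]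
  rw [OrthogonalFamily.linearIsometry_apply_single]
  simp

theorem star_basisShift_apply (α : ι) :
    star (basisShift b hτ).toContinuousLinearMap (b (τ α)) = b α := by
  classical
  refine eq_of_forall_inner_basis_eq b fun γ => ?_
  rw [ContinuousLinearMap.star_eq_adjoint, ContinuousLinearMap.adjoint_inner_right]
  simp only [LinearIsometry.coe_toContinuousLinearMap, basisShift_apply,
    orthonormal_iff_ite.mp b.orthonormal, hτ.eq_iff]

theorem star_basisShift_apply_of_notMem_range {β : ι} (hβ : β ∉ Set.range τ) :
    star (basisShift b hτ).toContinuousLinearMap (b β) = 0 := by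
  classical
  refine eq_of_forall_inner_basis_eq b fun γ => ?_
  have hne : τ γ ≠ β := fun h => hβ ⟨γ, h⟩
  rw [ContinuousLinearMap.star_eq_adjoint, ContinuousLinearMap.adjoint_inner_right]
  simp only [LinearIsometry.coe_toContinuousLinearMap, basisShift_apply,
    orthonormal_iff_ite.mp b.orthonormal, hne, if_false, inner_zero_right]

theorem star_basisShift_mul_self :
    star (basisShift b hτ).toContinuousLinearMap * (basisShift b hτ).toContinuousLinearMap = 1 :=
  (ContinuousLinearMap.norm_map_iff_adjoint_comp_self _).mp (basisShift b hτ).norm_map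

theorem commute_basisShift_star (hcomm : Function.Commute τ σ)
    (hrange : ∀ β, τ β ∈ Set.range σ → β ∈ Set.range σ) :
    Commute (basisShift b hτ).toContinuousLinearMap
      (star (basisShift b hσ).toContinuousLinearMap) := by
  refine ContinuousLinearMap.ext_on (s := Set.range b)
    (Submodule.dense_iff_topologicalClosure_eq_top.mpr b.dense_span) ?_
  rintro _ ⟨α, rfl⟩
  change basisShift b hτ (star (basisShift b hσ).toContinuousLinearMap (b α)) =
    star (basisShift b hσ).toContinuousLinearMap (basisShift b hτ (b α))
  rw [basisShift_apply]
  by_cases hα : α ∈ Set.range σ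
  · obtain ⟨γ, rfl⟩ := hα
    rw [star_basisShift_apply, basisShift_apply, hcomm γ, star_basisShift_apply]
  · rw [star_basisShift_apply_of_notMem_range b hσ hα, map_zero,
      star_basisShift_apply_of_notMem_range b hσ (mt (hrange α) hα)]

end BasisShift

section Hardy

theorem inverse_one_sub_smul_mul {𝕜 A : Type*} [CommSemiring 𝕜] [Ring A] [Algebra 𝕜 A] {s t : A}
    {c : 𝕜} (hts : t * s = 1) (hu : IsUnit (1 - c • t)) :
    Ring.inverse (1 - c • t) * s = s + c • Ring.inverse (1 - c • t) := by
  have hs : s = (1 - c • t) * (s + c • Ring.inverse (1 - c • t)) := by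
    rw [mul_add, mul_smul_comm, Ring.mul_inverse_cancel _ hu, sub_mul, one_mul, smul_mul_assoc,
      hts]
    abel
  conv_lhs => rw [hs]
  rw [← mul_assoc, Ring.inverse_mul_cancel _ hu, one_mul]

theorem prod_ofFn_mul {𝕜 A : Type*} [CommSemiring 𝕜] [Semiring A] [Algebra 𝕜 A] {d : ℕ}
    (h : Fin d → A) {x : A} {c : 𝕜} {i : Fin d} (hx : ∀ j ≠ i, Commute x (h j))
    (hi : h i * x = x + c • h i) :
    (List.ofFn h).prod * x =
      x * (List.ofFn (Function.update h i 1)).prod + c • (List.ofFn h).prod := by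
  induction d with
  | zero => exact i.elim0
  | succ d ih =>
    rw [List.ofFn_succ, List.ofFn_succ, List.prod_cons, List.prod_cons]
    obtain rfl | ⟨i, rfl⟩ := Fin.eq_zero_or_eq_succ i
    · have htail : Commute x (List.ofFn fun j => h (Fin.succ j)).prod := by
        refine Commute.list_prod_right _ _ fun y hy => ?_
        obtain ⟨j, rfl⟩ := List.mem_ofFn.mp hy
        exact hx _ (Fin.succ_ne_zero j)
      simp only [Function.update_self, one_mul, ne_eq, Fin.succ_ne_zero, not_false_eq_true,
        Function.update_of_ne]
      rw [mul_assoc, ← htail.eq, ← mul_assoc, hi, add_mul, smul_mul_assoc]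
    · have hupdate : (fun j : Fin d => Function.update h i.succ 1 j.succ) =
          Function.update (fun j : Fin d => h j.succ) i 1 :=
        Function.update_comp_eq_of_injective _ (Fin.succ_injective d) i 1
      rw [hupdate, mul_assoc, ih (fun j => h j.succ) (fun j hj => hx _ (by simpa using hj)) hi,
        Function.update_of_ne (Fin.succ_ne_zero i).symm, mul_add, ← mul_assoc,
        ← (hx 0 (Fin.succ_ne_zero i).symm).eq, mul_assoc, mul_smul_comm]

variable {d : ℕ} {E : Type*} [NormedAddCommGroup E] [InnerProductSpace ℂ E] [CompleteSpace E]
  {S : Fin d → E →L[ℂ] E} {z : Fin d → ℂ} {e : E}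

/-- The product `∏ i, (1 - zⁱ Sᵢ*)⁻¹`. For the coordinate shifts `Sᵢ` of the Hardy space and the
constant function `1`, the value of `f` at `z` is `⟪1, ∏ i, (1 - zⁱ Sᵢ*)⁻¹ f⟫`. -/
def backwardResolvent (S : Fin d → E →L[ℂ] E) (z : Fin d → ℂ) : E →L[ℂ] E :=
  (List.ofFn fun i => Ring.inverse (1 - z i • star (S i))).prod

theorem isUnit_one_sub_smul_star {T : E →L[ℂ] E} (hT : ‖T‖ ≤ 1) {c : ℂ} (hc : ‖c‖ < 1) :
    IsUnit (1 - c • star T) := by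
  refine isUnit_one_sub_of_norm_lt_one ?_
  rw [norm_smul, norm_star]
  exact (mul_le_of_le_one_right (norm_nonneg _) hT).trans_lt hc

theorem differentiableOn_backwardResolvent (hS : ∀ i, ‖S i‖ ≤ 1) :
    DifferentiableOn ℂ (backwardResolvent S) (polydisc d) := by
  have hinv : ∀ i, DifferentiableOn ℂ
      (fun z : Fin d → ℂ => Ring.inverse (1 - z i • star (S i))) (polydisc d) := by
    intro i z hz
    have hu := differentiableAt_inverse (isUnit_one_sub_smul_star (hS i) (hz i)) (𝕜 := ℂ)
    exact (hu.comp z (f := fun z : Fin d → ℂ => 1 - z i • star (S i))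
      (by fun_prop)).differentiableWithinAt
  have hmap : backwardResolvent S = fun z => ((List.finRange d).map fun i =>
      Ring.inverse (1 - z i • star (S i))).prod :=
    funext fun z => by rw [backwardResolvent, List.ofFn_eq_map]
  rw [hmap]
  intro z hz
  exact (HasFDerivWithinAt.list_prod' fun i _ =>
    (hinv i z hz).hasFDerivWithinAt).differentiableWithinAt

theorem inner_backwardResolvent_shift (hS : ∀ i, ‖S i‖ ≤ 1) (hSS : ∀ i, star (S i) * S i = 1)
    (hcomm : ∀ i j, i ≠ j → Commute (S i) (star (S j))) (he : ∀ i, star (S i) e = 0)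
    (hz : z ∈ polydisc d) (i : Fin d) (a : E) :
    inner ℂ e (backwardResolvent S z (S i a)) = z i * inner ℂ e (backwardResolvent S z a) := by
  have hunit : ∀ j, IsUnit (1 - z j • star (S j)) := fun j =>
    isUnit_one_sub_smul_star (hS j) (hz j)
  have hcomm_inv : ∀ j ≠ i, Commute (S i) (Ring.inverse (1 - z j • star (S j))) := by
    intro j hj
    have hsub : Commute (S i) (1 - z j • star (S j)) :=
      (Commute.one_right _).sub_right ((hcomm i j hj.symm).smul_right _)
    obtain ⟨u, hu⟩ := hunit j
    rw [← hu] at hsub ⊢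
    rw [Ring.inverse_unit]
    exact hsub.units_inv_right
  have hshift := prod_ofFn_mul (fun j => Ring.inverse (1 - z j • star (S j))) hcomm_inv
    (inverse_one_sub_smul_mul (hSS i) (hunit i))
  have horth : ∀ x, inner ℂ e (S i x) = 0 := fun x => by
    rw [← ContinuousLinearMap.adjoint_inner_left, ← ContinuousLinearMap.star_eq_adjoint, he,
      inner_zero_left]
  simpa [horth, inner_smul_right, backwardResolvent] using
    congrArg (fun Q : E →L[ℂ] E => inner ℂ e (Q a)) hshift

theorem backwardResolvent_apply_of_star_eq_zero (hS : ∀ i, ‖S i‖ ≤ 1)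
    (he : ∀ i, star (S i) e = 0) (hz : z ∈ polydisc d) : backwardResolvent S z e = e := by
  have hinv : ∀ i, Ring.inverse (1 - z i • star (S i)) e = e := fun i => by
    have hcancel := congrArg (fun Q : E →L[ℂ] E => Q e)
      (Ring.inverse_mul_cancel _ (isUnit_one_sub_smul_star (hS i) (hz i)))
    simpa [he] using hcancel
  have hstab : ∀ Q ∈ List.ofFn fun i => Ring.inverse (1 - z i • star (S i)),
      Q ∈ MulAction.stabilizerSubmonoid (E →L[ℂ] E) e := by
    intro Q hQ
    obtain ⟨i, rfl⟩ := List.mem_ofFn.mp hQ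
    exact hinv i
  exact Submonoid.list_prod_mem _ hstab

/-- Multi-indices index the monomial basis of the Hardy space, and `Sᵢ` raises the `i`-th
exponent. -/
theorem exists_coordinate_shifts (b : HilbertBasis (Fin d → ℕ) ℂ E) :
    ∃ S : Fin d → E →L[ℂ] E, (∀ i, ‖S i‖ ≤ 1) ∧ (∀ i, star (S i) * S i = 1) ∧
      (∀ i j, i ≠ j → Commute (S i) (star (S j))) ∧ ∀ i, star (S i) (b 0) = 0 := by
  have hinj : ∀ i : Fin d, Function.Injective (· + Pi.single i 1 : (Fin d → ℕ) → Fin d → ℕ) :=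
    fun i => add_left_injective _
  have hrange : ∀ (i : Fin d) (α : Fin d → ℕ),
      α ∈ Set.range (· + Pi.single i 1 : (Fin d → ℕ) → Fin d → ℕ) ↔ 1 ≤ α i := by
    refine fun i α => ⟨?_, fun h => ⟨α - Pi.single i 1, tsub_add_cancel_of_le ?_⟩⟩
    · rintro ⟨γ, rfl⟩
      simp
    · intro l
      obtain rfl | hl := eq_or_ne l i <;> simp [*]
  refine ⟨fun i => (basisShift b (hinj i)).toContinuousLinearMap,
    fun i => (basisShift b (hinj i)).norm_toContinuousLinearMap_le,
    fun i => star_basisShift_mul_self b (hinj i), fun i j hij => ?_,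
    fun i => star_basisShift_apply_of_notMem_range b (hinj i) (by simp [hrange])⟩
  refine commute_basisShift_star b (hinj i) (hinj j) (fun α => add_right_comm _ _ _) fun β hβ => ?_
  simpa [hrange, hij.symm] using hβ

theorem exists_admissibleKernel_one (d : ℕ) :
    ∃ (k : AdmissibleKernel d) (f : k.H), ∀ z, f z = 1 := by
  let E := lp (fun _ : Fin d → ℕ => ℂ) 2
  let b : HilbertBasis (Fin d → ℕ) ℂ E := .ofRepr (LinearIsometryEquiv.refl ℂ E)
  obtain ⟨S, hS, hSS, hcomm, hS0⟩ := exists_coordinate_shifts b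
  let ev : polydisc d → E →L[ℂ] ℂ := fun z => (innerSL ℂ (b 0)).comp (backwardResolvent S z.1)
  have hol : ∀ a, DifferentiableOn ℂ (extendZero fun z => ev z a) (polydisc d) := fun a => by
    have hev : DifferentiableOn ℂ (fun z => inner ℂ (b 0) (backwardResolvent S z a)) (polydisc d) :=
      (innerSL ℂ (b 0)).differentiable.comp_differentiableOn
        ((differentiableOn_backwardResolvent hS).clm_apply (differentiableOn_const a))
    exact hev.congr (extendZero_eqOn fun z => rfl)
  obtain ⟨k, -, hk⟩ := exists_admissibleKernel_of_evaluations ev hol fun i a =>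
    ⟨S i a, fun z => inner_backwardResolvent_shift hS hSS hcomm hS0 z.2 i a,
      by simpa using (S i).le_of_opNorm_le (hS i) a⟩
  obtain ⟨f, -, hf⟩ := hk (b 0)
  refine ⟨k, f, fun z => (hf z).trans ?_⟩
  change inner ℂ (b 0) (backwardResolvent S z.1 (b 0)) = 1
  rw [backwardResolvent_apply_of_star_eq_zero hS hS0 z.2, inner_self_eq_norm_sq_to_K,
    b.orthonormal.1 0]
  simp

end Hardy

section GraphKernel

/-- Renorming by `‖a‖² + ‖Λ a‖²`: the new space consists of the same functions. -/
theorem exists_graph_kernel {d : ℕ} (k₀ : AdmissibleKernel d) {F : Type} [NormedAddCommGroup F]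
    [InnerProductSpace ℂ F] [CompleteSpace F] (Λ : k₀.H →L[ℂ] F)
    (hΛ : ∀ (i : Fin d) (f g : k₀.H), (∀ z, g z = z.1 i * f z) → ‖Λ g‖ ≤ ‖Λ f‖) :
    ∃ k : AdmissibleKernel d,
      (∀ f : k.H, ∃ a : k₀.H, ‖a‖ ^ 2 + ‖Λ a‖ ^ 2 = ‖f‖ ^ 2 ∧ ∀ z, f z = a z) ∧
      ∀ a : k₀.H, ∃ f : k.H, ‖f‖ ^ 2 ≤ ‖a‖ ^ 2 + ‖Λ a‖ ^ 2 ∧ ∀ z, f z = a z := by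
  let T : WithLp 2 (k₀.H × F) →L[ℂ] F :=
    WithLp.sndL 2 ℂ k₀.H F - Λ.comp (WithLp.fstL 2 ℂ k₀.H F)
  have hgraph : ∀ x ∈ T.ker, x.snd = Λ x.fst := fun x hx => sub_eq_zero.mp hx
  have hnorm : ∀ x : T.ker, ‖x.1.fst‖ ^ 2 + ‖Λ x.1.fst‖ ^ 2 = ‖x‖ ^ 2 := fun x => by
    rw [← hgraph x.1 x.2, ← WithLp.prod_norm_sq_eq_of_L2, Submodule.coe_norm]
  let lift : k₀.H → T.ker := fun a => ⟨WithLp.toLp 2 (a, Λ a), sub_self _⟩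
  have : CompleteSpace T.ker := T.isClosed_ker.completeSpace_coe
  let ev : polydisc d → T.ker →L[ℂ] ℂ := fun z =>
    ((ContinuousLinearMap.proj (R := ℂ) (φ := fun _ : polydisc d => ℂ) z).comp
      (RKHS.coeCLM ℂ)).comp ((WithLp.fstL 2 ℂ k₀.H F).comp T.ker.subtypeL)
  obtain ⟨k, hk₁, hk₂⟩ := exists_admissibleKernel_of_evaluations ev
    (fun x => k₀.holomorphic x.1.fst) fun i x => by
      obtain ⟨g, hg, hgn⟩ := k₀.contraction i x.1.fst
      refine ⟨lift g, hg, le_of_sq_le_sq ?_ (norm_nonneg _)⟩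
      rw [← hnorm, ← hnorm]
      exact add_le_add (pow_le_pow_left₀ (norm_nonneg _) hgn 2)
        (pow_le_pow_left₀ (norm_nonneg _) (hΛ i _ _ hg) 2)
  refine ⟨k, fun f => ?_, fun a => ?_⟩
  · obtain ⟨x, hx, hfx⟩ := hk₁ f
    exact ⟨x.1.fst, by rw [hnorm, hx], hfx⟩
  · obtain ⟨f, hf, hfa⟩ := hk₂ (lift a)
    exact ⟨f, (pow_le_pow_left₀ (norm_nonneg _) hf 2).trans_eq (hnorm (lift a)).symm, hfa⟩

end GraphKernel

/-! ### The algebra of values at the nodes -/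

section NodeAlgebra

variable {N : ℕ} (s : Fin N → ℕ)

/-- The indices of the entries of a family of square matrices. -/
abbrev EntryIndex : Type := Σ j, Fin (s j) × Fin (s j)

/-- The basis of matrix units of the algebra of families of square matrices, through which its
elements become vectors and left multiplications become matrices. -/
def entryBasis : Module.Basis (EntryIndex s) ℂ (∀ j, Matrix (Fin (s j)) (Fin (s j)) ℂ) :=
  Pi.basis fun j => Matrix.stdBasis ℂ (Fin (s j)) (Fin (s j))

variable {s}

theorem entryBasis_equivFun_apply (B : ∀ j, Matrix (Fin (s j)) (Fin (s j)) ℂ) (x : EntryIndex s) :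
    (entryBasis s).equivFun B x = B x.1 x.2.1 x.2.2 := by
  simp [entryBasis, Matrix.stdBasis]

theorem leftMulMatrix_mulVec_equivFun (B D : ∀ j, Matrix (Fin (s j)) (Fin (s j)) ℂ) :
    Algebra.leftMulMatrix (entryBasis s) B *ᵥ (entryBasis s).equivFun D =
      (entryBasis s).equivFun (B * D) :=
  Algebra.leftMulMatrix_mulVec_repr _ _ _

variable {d : ℕ} {A : ∀ j, Fin d → Matrix (Fin (s j)) (Fin (s j)) ℂ}

theorem commute_leftMulMatrix (hA : ∀ j, IsNode (A j)) (i i' : Fin d) :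
    Commute (Algebra.leftMulMatrix (entryBasis s) fun j => A j i)
      (Algebra.leftMulMatrix (entryBasis s) fun j => A j i') :=
  have h : Commute (fun j => A j i) (fun j => A j i') := funext fun j => ((hA j).commute i i').eq
  h.map _

theorem tendsto_leftMulMatrix_pow (hA : ∀ j, IsNode (A j)) (i : Fin d) :
    Tendsto (fun n => (Algebra.leftMulMatrix (entryBasis s) fun j => A j i) ^ n) atTop (𝓝 0) := by
  simp only [← map_pow]
  have hcont : Continuous (Algebra.leftMulMatrix (entryBasis s)) :=
    (Algebra.leftMulMatrix (entryBasis s)).toLinearMap.continuous_of_finiteDimensional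
  rw [← map_zero (Algebra.leftMulMatrix (entryBasis s))]
  exact (hcont.tendsto 0).comp (tendsto_pi_nhds.mpr fun j => (hA j).tendsto_pow i)

open scoped MatrixOrder ComplexOrder

/-- The Hermitian form with matrix `H`, evaluated at the vector of entries of `B`. -/
def entryForm (H : Matrix (EntryIndex s) (EntryIndex s) ℂ)
    (B : ∀ j, Matrix (Fin (s j)) (Fin (s j)) ℂ) : ℝ :=
  (star ((entryBasis s).equivFun B) ⬝ᵥ (H *ᵥ (entryBasis s).equivFun B)).re

theorem entryForm_smul (r : ℝ) (H : Matrix (EntryIndex s) (EntryIndex s) ℂ)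
    (B : ∀ j, Matrix (Fin (s j)) (Fin (s j)) ℂ) : entryForm (r • H) B = r * entryForm H B := by
  simp [entryForm, Matrix.smul_mulVec, dotProduct_smul]

theorem entryForm_mono {H K : Matrix (EntryIndex s) (EntryIndex s) ℂ} (h : H ≤ K)
    (B : ∀ j, Matrix (Fin (s j)) (Fin (s j)) ℂ) : entryForm H B ≤ entryForm K B := by
  have hnonneg := (Complex.le_def.mp
    ((Matrix.le_iff.mp h).dotProduct_mulVec_nonneg ((entryBasis s).equivFun B))).1
  rw [Matrix.sub_mulVec, dotProduct_sub, Complex.sub_re, Complex.zero_re] at hnonneg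
  exact sub_nonneg.mp hnonneg

theorem entryForm_mul (H : Matrix (EntryIndex s) (EntryIndex s) ℂ)
    (B D : ∀ j, Matrix (Fin (s j)) (Fin (s j)) ℂ) :
    entryForm H (B * D) = entryForm ((Algebra.leftMulMatrix (entryBasis s) B)ᴴ * H *
      Algebra.leftMulMatrix (entryBasis s) B) D := by
  rw [entryForm, ← leftMulMatrix_mulVec_equivFun, Matrix.star_mulVec, ← Matrix.dotProduct_mulVec,
    Matrix.mulVec_mulVec, Matrix.mulVec_mulVec, Matrix.mul_assoc, entryForm]

end NodeAlgebra

section NodeSpace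

variable {d N : ℕ} {s : Fin N → ℕ} {A : ∀ j, Fin d → Matrix (Fin (s j)) (Fin (s j)) ℂ}

theorem AdmissibleKernel.inner_nodeKernel_single (k : AdmissibleKernel d) {m : ℕ}
    {M : Fin d → Matrix (Fin m) (Fin m) ℂ} (hM : IsNode M) (a b : Fin m) (f : k.H) :
    inner ℂ (k.nodeKernel hM (Pi.single b 1) (Pi.single a 1)) f =
      matEval (extendZero f) M a b := by
  rw [k.inner_nodeKernel]
  simp

theorem exists_inner_eq_of_subspace {𝕜 E : Type*} [RCLike 𝕜] [NormedAddCommGroup E]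
    [InnerProductSpace 𝕜 E] [CompleteSpace E] (p : Submodule 𝕜 E) (T : p →L[𝕜] 𝕜) :
    ∃ g : E, ‖g‖ = ‖T‖ ∧ ∀ x : p, inner 𝕜 g x.1 = T x := by
  obtain ⟨T', hT', hn⟩ := exists_extension_norm_eq p T
  refine ⟨(InnerProductSpace.toDual 𝕜 E).symm T', by simp [hn], fun x => ?_⟩
  rw [InnerProductSpace.toDual_symm_apply, hT']

/-- The function `g` is the adjoint of `R`, applied to `f`. -/
theorem AdmissibleKernel.IsR.exists_matEval_eq {k : AdmissibleKernel d} {hA : ∀ j, IsNode (A j)}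
    {φ : Fin N → (Fin d → ℂ) → ℂ} {R : k.nodeSpace hA →L[ℂ] k.nodeSpace hA} (hR : k.IsR hA φ R)
    (f : k.H) : ∃ g : k.H, ‖g‖ ≤ ‖R‖ * ‖f‖ ∧
      ∀ j, matEval (extendZero g) (A j) = matEval (φ j) (A j) * matEval (extendZero f) (A j) := by
  let T : k.nodeSpace hA →L[ℂ] ℂ := ((innerSL ℂ f).comp (k.nodeSpace hA).subtypeL).comp R
  obtain ⟨g, hg, hgT⟩ := exists_inner_eq_of_subspace (k.nodeSpace hA) T
  refine ⟨g, ?_, fun j => ?_⟩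
  · rw [hg]
    refine ContinuousLinearMap.opNorm_le_bound _ (by positivity) fun x => ?_
    calc ‖inner ℂ f (R x).1‖ ≤ ‖f‖ * ‖(R x).1‖ := norm_inner_le_norm _ _
      _ ≤ ‖f‖ * (‖R‖ * ‖x‖) := mul_le_mul_of_nonneg_left (R.le_opNorm x) (norm_nonneg _)
      _ = ‖R‖ * ‖f‖ * ‖x‖ := by ring
  · ext a b
    let K : k.nodeSpace hA := ⟨_, k.nodeKernel_mem hA j (Pi.single b 1) (Pi.single a 1)⟩
    have hTK : T K = inner ℂ f
        (k.nodeKernel (hA j) (Pi.single b 1) ((matEval (φ j) (A j))ᴴ *ᵥ Pi.single a 1)) :=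
      congrArg (fun x : k.nodeSpace hA => inner ℂ f x.1) (hR j _ _)
    have hinner := (hgT K).trans hTK
    rw [← inner_conj_symm, ← inner_conj_symm f, k.inner_nodeKernel_single,
      k.inner_nodeKernel] at hinner
    rw [(starRingEnd ℂ).injective hinner, Matrix.star_mulVec, Matrix.conjTranspose_conjTranspose,
      ← Matrix.dotProduct_mulVec, Matrix.mulVec_mulVec]
    simp

theorem AdmissibleKernel.IsR.unique {k : AdmissibleKernel d} {hA : ∀ j, IsNode (A j)}
    {φ : Fin N → (Fin d → ℂ) → ℂ} {R R' : k.nodeSpace hA →L[ℂ] k.nodeSpace hA}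
    (hR : k.IsR hA φ R) (hR' : k.IsR hA φ R') : R = R' := by
  refine ContinuousLinearMap.coe_injective
    ((Submodule.linearMap_eq_iff_of_eq_span _ _ rfl).mpr ?_)
  rintro ⟨_, j, u, v, rfl⟩
  exact (hR j u v).trans (hR' j u v).symm

theorem AdmissibleKernel.exists_isR_of_normR_le {k : AdmissibleKernel d}
    {hA : ∀ j, IsNode (A j)} {φ : Fin N → (Fin d → ℂ) → ℂ} {C : ℝ} (hC : 0 ≤ C)
    (h : k.normR hA φ ≤ ENNReal.ofReal C) : ∃ R, k.IsR hA φ R ∧ ‖R‖ ≤ C := by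
  obtain ⟨R, hlt⟩ := iInf_lt_iff.mp (h.trans_lt ENNReal.ofReal_lt_top)
  obtain ⟨hR, -⟩ := iInf_lt_iff.mp hlt
  have hRC : ‖R‖ₑ ≤ ENNReal.ofReal C :=
    le_trans (le_iInf₂ fun R' hR' => by rw [hR.unique hR']) h
  rw [← ofReal_norm] at hRC
  exact ⟨R, hR, (ENNReal.ofReal_le_ofReal_iff hC).mp hRC⟩

end NodeSpace

section Positivity

open scoped MatrixOrder ComplexOrder

variable {d N : ℕ} {s : Fin N → ℕ} {A : ∀ j, Fin d → Matrix (Fin (s j)) (Fin (s j)) ℂ}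

theorem AdmissibleKernel.exists_norm_sq_eq_entryForm (k : AdmissibleKernel d)
    (hA : ∀ j, IsNode (A j)) {H : Matrix (EntryIndex s) (EntryIndex s) ℂ} (hH : 0 ≤ H) :
    ∃ V : k.H →L[ℂ] EuclideanSpace ℂ (EntryIndex s),
      ∀ f, ‖V f‖ ^ 2 = entryForm H fun j => matEval (extendZero f) (A j) := by
  obtain ⟨W, rfl⟩ := CStarAlgebra.nonneg_iff_eq_star_mul_self.mp hH
  let eval : k.H →L[ℂ] EntryIndex s → ℂ := ContinuousLinearMap.pi fun x =>
    innerSL ℂ (k.nodeKernel (hA x.1) (Pi.single x.2.2 1) (Pi.single x.2.1 1))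
  have heval : ∀ f, eval f = (entryBasis s).equivFun fun j => matEval (extendZero f) (A j) :=
    fun f => funext fun x =>
      (k.inner_nodeKernel_single (hA x.1) _ _ f).trans
        (entryBasis_equivFun_apply (fun j => matEval (extendZero f) (A j)) x).symm
  refine ⟨((PiLp.continuousLinearEquiv 2 ℂ fun _ : EntryIndex s => ℂ).symm :
    _ →L[ℂ] EuclideanSpace ℂ (EntryIndex s)).comp
      ((Matrix.toLin' W).toContinuousLinearMap.comp eval), fun f => ?_⟩
  have hnorm : ∀ x : EntryIndex s → ℂ,
      ‖(WithLp.toLp 2 x : EuclideanSpace ℂ (EntryIndex s))‖ ^ 2 = (star x ⬝ᵥ x).re := fun x => by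
    rw [star_dotProduct_self, Complex.ofReal_re, EuclideanSpace.norm_sq_eq]
  refine (hnorm (W *ᵥ eval f)).trans ?_
  rw [entryForm, heval, Matrix.star_mulVec, ← Matrix.dotProduct_mulVec, Matrix.mulVec_mulVec,
    Matrix.star_eq_conjTranspose]

theorem AdmissibleKernel.matEval_eq_mul_of_forall_eq_mul (k : AdmissibleKernel d) {m : ℕ}
    {M : Fin d → Matrix (Fin m) (Fin m) ℂ} (hM : IsNode M) {i : Fin d} {f g : k.H}
    (hg : ∀ z, g z = z.1 i * f z) :
    matEval (extendZero g) M = M i * matEval (extendZero f) M := by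
  rw [← hM.matEval_coord_mul (k.holomorphic f)]
  refine hM.matEval_congr (extendZero_eqOn fun z => ?_)
  rw [hg, extendZero_apply]

/-- Test the hypothesis on the kernel obtained by adding the form `H` to the norm of `k`. -/
theorem AdmissibleKernel.entryForm_le_of_normR_le (k : AdmissibleKernel d) {f₁ : k.H}
    (hf₁ : ∀ z, f₁ z = 1) {hA : ∀ j, IsNode (A j)} {φ : Fin N → (Fin d → ℂ) → ℂ} {C : ℝ}
    (hC : 0 ≤ C) (h : ∀ k : AdmissibleKernel d, k.normR hA φ ≤ ENNReal.ofReal C)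
    {H : Matrix (EntryIndex s) (EntryIndex s) ℂ} (hH : 0 ≤ H)
    (hL : ∀ i, (Algebra.leftMulMatrix (entryBasis s) fun j => A j i)ᴴ * H *
      (Algebra.leftMulMatrix (entryBasis s) fun j => A j i) ≤ H) :
    entryForm H (fun j => matEval (φ j) (A j)) ≤ C ^ 2 * (‖f₁‖ ^ 2 + entryForm H 1) := by
  obtain ⟨V, hV⟩ := k.exists_norm_sq_eq_entryForm hA hH
  have hVmul : ∀ (i : Fin d) (f g : k.H), (∀ z, g z = z.1 i * f z) → ‖V g‖ ≤ ‖V f‖ := by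
    intro i f g hg
    refine le_of_sq_le_sq ?_ (norm_nonneg _)
    simp only [hV, k.matEval_eq_mul_of_forall_eq_mul (hA _) hg]
    exact (entryForm_mul H (fun j => A j i) _).trans_le (entryForm_mono (hL i) _)
  have hone : ∀ j, matEval (extendZero f₁) (A j) = 1 := fun j => by
    rw [← (hA j).matEval_one]
    exact (hA j).matEval_congr (extendZero_eqOn hf₁)
  obtain ⟨k', hk'₁, hk'₂⟩ := exists_graph_kernel k V hVmul
  obtain ⟨R, hR, hRC⟩ := AdmissibleKernel.exists_isR_of_normR_le hC (h k')
  obtain ⟨f, hf, hff₁⟩ := hk'₂ f₁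
  obtain ⟨g, hg, hgφ⟩ := hR.exists_matEval_eq f
  obtain ⟨a, ha, hga⟩ := hk'₁ g
  have haφ : ∀ j, matEval (extendZero a) (A j) = matEval (φ j) (A j) := fun j => by
    rw [← show ⇑g = ⇑a from funext hga, hgφ, show ⇑f = ⇑f₁ from funext hff₁, hone, mul_one]
  have hVa : ‖V a‖ ^ 2 = entryForm H fun j => matEval (φ j) (A j) := by simp only [hV, haφ]
  have hVf₁ : ‖V f₁‖ ^ 2 = entryForm H 1 := by simp only [hV, hone]; rfl
  calc entryForm H (fun j => matEval (φ j) (A j)) = ‖V a‖ ^ 2 := hVa.symm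
    _ ≤ ‖a‖ ^ 2 + ‖V a‖ ^ 2 := le_add_of_nonneg_left (sq_nonneg _)
    _ = ‖g‖ ^ 2 := ha
    _ ≤ (C * ‖f‖) ^ 2 := pow_le_pow_left₀ (norm_nonneg _)
        (hg.trans (mul_le_mul_of_nonneg_right hRC (norm_nonneg _))) 2
    _ = C ^ 2 * ‖f‖ ^ 2 := mul_pow _ _ _
    _ ≤ C ^ 2 * (‖f₁‖ ^ 2 + entryForm H 1) := by
        rw [← hVf₁]
        exact mul_le_mul_of_nonneg_left hf (sq_nonneg C)

theorem entryForm_matEval_le {hA : ∀ j, IsNode (A j)} {φ : Fin N → (Fin d → ℂ) → ℂ} {C : ℝ}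
    (hC : 0 ≤ C) (h : ∀ k : AdmissibleKernel d, k.normR hA φ ≤ ENNReal.ofReal C)
    {H : Matrix (EntryIndex s) (EntryIndex s) ℂ} (hH : 0 ≤ H)
    (hL : ∀ i, (Algebra.leftMulMatrix (entryBasis s) fun j => A j i)ᴴ * H *
      (Algebra.leftMulMatrix (entryBasis s) fun j => A j i) ≤ H) :
    entryForm H (fun j => matEval (φ j) (A j)) ≤ C ^ 2 * entryForm H 1 := by
  obtain ⟨k, f₁, hf₁⟩ := exists_admissibleKernel_one d
  -- Replace `H` by `r • H` and let `r → ∞`: the contribution of `‖f₁‖` disappears.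
  have hscaled : ∀ r : ℝ, 0 < r →
      r * entryForm H (fun j => matEval (φ j) (A j)) ≤
        C ^ 2 * (‖f₁‖ ^ 2 + r * entryForm H 1) := by
    intro r hr
    rw [← entryForm_smul, ← entryForm_smul]
    refine k.entryForm_le_of_normR_le hf₁ hC h (smul_nonneg hr.le hH) fun i => ?_
    rw [mul_smul_comm, smul_mul_assoc]
    exact smul_le_smul_of_nonneg_left (hL i) hr.le
  have hdiv : ∀ᶠ r : ℝ in atTop, entryForm H (fun j => matEval (φ j) (A j)) ≤
      C ^ 2 * (‖f₁‖ ^ 2 / r + entryForm H 1) := by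
    filter_upwards [eventually_gt_atTop 0] with r hr
    refine le_of_mul_le_mul_left ((hscaled r hr).trans_eq ?_) hr
    field_simp
  have hlim : Tendsto (fun r : ℝ => C ^ 2 * (‖f₁‖ ^ 2 / r + entryForm H 1)) atTop
      (𝓝 (C ^ 2 * entryForm H 1)) := by
    have hvanish : Tendsto (fun r : ℝ => ‖f₁‖ ^ 2 / r) atTop (𝓝 0) :=
      tendsto_const_nhds.div_atTop tendsto_id
    simpa using (hvanish.add_const (entryForm H 1)).const_mul (C ^ 2)
  exact ge_of_tendsto hlim hdiv

theorem exists_node_realization {hA : ∀ j, IsNode (A j)} {φ : Fin N → (Fin d → ℂ) → ℂ} {C : ℝ}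
    (hC : 0 ≤ C) (h : ∀ k : AdmissibleKernel d, k.normR hA φ ≤ ENNReal.ofReal C) :
    ∃ (κ : Type) (_ : Fintype κ) (_ : DecidableEq κ) (p : κ → Fin d)
      (U : Matrix (Option κ) (Option κ) ℂ) (g : κ → ∀ j, Matrix (Fin (s j)) (Fin (s j)) ℂ),
      Uᴴ * U ≤ 1 ∧
      (∀ j, matEval (φ j) (A j) = (C * U none none) • (1 : Matrix (Fin (s j)) (Fin (s j)) ℂ) +
        ∑ t, U none (some t) • (A j (p t) * g t j)) ∧
      ∀ r j, g r j = (C * U (some r) none) • (1 : Matrix (Fin (s j)) (Fin (s j)) ℂ) +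
        ∑ t, U (some r) (some t) • (A j (p t) * g t j) := by
  obtain ⟨U, g, hU, hφ, hg⟩ := exists_contractive_realization (commute_leftMulMatrix hA)
    (tendsto_leftMulMatrix_pow hA) fun H => entryForm_matEval_le (H := H) hC h
  obtain ⟨G, rfl⟩ : ∃ G : Fin d × EntryIndex s → ∀ j, Matrix (Fin (s j)) (Fin (s j)) ℂ,
      g = fun t => (entryBasis s).equivFun (G t) :=
    ⟨fun t => (entryBasis s).equivFun.symm (g t),
      funext fun t => ((entryBasis s).equivFun.apply_symm_apply (g t)).symm⟩
  simp only [leftMulMatrix_mulVec_equivFun, ← map_smul, ← map_sum, ← map_add,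
    (entryBasis s).equivFun.injective.eq_iff] at hφ hg
  refine ⟨Fin d × EntryIndex s, inferInstance, inferInstance, Prod.fst, U, G, hU, fun j => ?_,
    fun r j => ?_⟩
  · simpa using congrFun hφ j
  · simpa using congrFun (hg r) j

end Positivity

/-! ### Transfer functions -/

section System

open scoped MatrixOrder ComplexOrder

variable {d : ℕ} {κ : Type*} [Fintype κ]

theorem norm_sq_add_sum_norm_sq_le [DecidableEq κ] {U : Matrix (Option κ) (Option κ) ℂ}
    (hU : Uᴴ * U ≤ 1) {E : Type*} [NormedAddCommGroup E] [InnerProductSpace ℂ E] (x₀ : E)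
    (x : κ → E) :
    ‖U none none • x₀ + ∑ t, U none (some t) • x t‖ ^ 2 +
        ∑ r, ‖U (some r) none • x₀ + ∑ t, U (some r) (some t) • x t‖ ^ 2 ≤
      ‖x₀‖ ^ 2 + ∑ t, ‖x t‖ ^ 2 := by
  simpa only [Fintype.sum_option, Option.elim_none, Option.elim_some] using
    sum_norm_sq_sum_smul_le hU fun o : Option κ => o.elim x₀ x

theorem norm_sq_coord_mul_le {z : Fin d → ℂ} (hz : z ∈ polydisc d) (i : Fin d) (c : ℂ) :
    ‖z i * c‖ ^ 2 ≤ ‖c‖ ^ 2 := by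
  rw [norm_mul, mul_pow]
  exact mul_le_of_le_one_left (sq_nonneg _) (pow_le_one₀ (norm_nonneg _) (hz i).le)

theorem norm_sq_coord_mul_lt {z : Fin d → ℂ} (hz : z ∈ polydisc d) (i : Fin d) {c : ℂ}
    (hc : c ≠ 0) : ‖z i * c‖ ^ 2 < ‖c‖ ^ 2 := by
  rw [norm_mul, mul_pow]
  exact mul_lt_of_lt_one_left (pow_pos (norm_pos_iff.mpr hc) 2)
    (pow_lt_one₀ (norm_nonneg _) (hz i) two_ne_zero)

theorem differentiableOn_coord_mul {f : (Fin d → ℂ) → ℂ} (hf : DifferentiableOn ℂ f (polydisc d))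
    (i : Fin d) : DifferentiableOn ℂ (fun z => z i * f z) (polydisc d) :=
  (differentiable_apply i).differentiableOn.fun_mul hf

variable [DecidableEq κ] (U : Matrix (Option κ) (Option κ) ℂ) (p : κ → Fin d)

/-- The matrix `D E(z)` of a system with block matrix `U = [a b; c D]`, indexed by `Option κ` with
`none` for the first block, where `E(z)` is the diagonal matrix of the coordinates `z (p t)`. -/
def systemMatrix (z : Fin d → ℂ) : Matrix κ κ ℂ :=
  U.submatrix some some * Matrix.diagonal fun t => z (p t)

/-- The resolvent `(1 - D E(z))⁻¹` of a system with block matrix `U = [a b; c D]`. -/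
def systemResolvent (z : Fin d → ℂ) : Matrix κ κ ℂ :=
  (1 - systemMatrix U p z)⁻¹

/-- The state vector `(1 - D E(z))⁻¹ c` of a system with block matrix `U = [a b; c D]`. -/
def systemState (r : κ) (z : Fin d → ℂ) : ℂ :=
  (systemResolvent U p z *ᵥ fun t => U (some t) none) r

/-- The transfer function `a + b E(z) (1 - D E(z))⁻¹ c` of a system with block matrix
`U = [a b; c D]`. -/
def transferFunction (z : Fin d → ℂ) : ℂ :=
  U none none + ∑ t, U none (some t) * (z (p t) * systemState U p t z)

variable {U p}

theorem systemMatrix_apply (z : Fin d → ℂ) (r t : κ) :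
    systemMatrix U p z r t = U (some r) (some t) * z (p t) := by
  simp [systemMatrix]

theorem systemMatrix_mulVec_apply (z : Fin d → ℂ) (v : κ → ℂ) (r : κ) :
    (systemMatrix U p z *ᵥ v) r = ∑ t, U (some r) (some t) * (z (p t) * v t) := by
  simp only [Matrix.mulVec, dotProduct, systemMatrix_apply, mul_assoc]

theorem isUnit_one_sub_systemMatrix (hU : Uᴴ * U ≤ 1) {z : Fin d → ℂ} (hz : z ∈ polydisc d) :
    IsUnit (1 - systemMatrix U p z) := by
  rw [Matrix.isUnit_iff_isUnit_det, isUnit_iff_ne_zero]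
  intro hdet
  obtain ⟨v, hv₀, hv⟩ := Matrix.exists_mulVec_eq_zero_iff.mpr hdet
  rw [Matrix.sub_mulVec, Matrix.one_mulVec, sub_eq_zero] at hv
  have hstate : ∀ r, ∑ t, U (some r) (some t) * (z (p t) * v t) = v r := fun r => by
    rw [← systemMatrix_mulVec_apply, ← hv]
  have hcontr := norm_sq_add_sum_norm_sq_le hU 0 fun t => z (p t) * v t
  simp only [smul_eq_mul, mul_zero, zero_add, hstate, norm_zero] at hcontr
  have hle : ∑ t, ‖v t‖ ^ 2 ≤ ∑ t, ‖z (p t) * v t‖ ^ 2 := by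
    linarith [sq_nonneg ‖∑ t, U none (some t) * (z (p t) * v t)‖]
  obtain ⟨t₀, ht₀⟩ := Function.ne_iff.mp hv₀
  exact hle.not_gt (Finset.sum_lt_sum (fun t _ => norm_sq_coord_mul_le hz _ _)
    ⟨t₀, Finset.mem_univ _, norm_sq_coord_mul_lt hz _ ht₀⟩)

open scoped Matrix.Norms.L2Operator in
theorem differentiableOn_systemResolvent (hU : Uᴴ * U ≤ 1) (r t : κ) :
    DifferentiableOn ℂ (fun z => systemResolvent U p z r t) (polydisc d) := by
  let D : (Fin d → ℂ) →L[ℂ] Matrix κ κ ℂ := LinearMap.toContinuousLinearMap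
    (LinearMap.mulLeft ℂ (U.submatrix some some) ∘ₗ Matrix.diagonalLinearMap κ ℂ ℂ ∘ₗ
      LinearMap.funLeft ℂ ℂ p)
  have hinv : DifferentiableOn ℂ (systemResolvent U p) (polydisc d) := fun z hz => by
    have heq : systemResolvent U p = fun z => Ring.inverse (1 - D z) :=
      funext fun z => Matrix.nonsing_inv_eq_ringInverse _
    rw [heq]
    exact ((differentiableAt_inverse (isUnit_one_sub_systemMatrix hU hz)).comp z
      (D.differentiableAt.const_sub 1)).differentiableWithinAt
  exact (LinearMap.toContinuousLinearMap
    (Matrix.entryLinearMap ℂ ℂ r t)).differentiable.comp_differentiableOn hinv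

theorem differentiableOn_systemState (hU : Uᴴ * U ≤ 1) (r : κ) :
    DifferentiableOn ℂ (systemState U p r) (polydisc d) :=
  DifferentiableOn.fun_sum fun t _ => (differentiableOn_systemResolvent hU r t).mul_const _

theorem differentiableOn_transferFunction (hU : Uᴴ * U ≤ 1) :
    DifferentiableOn ℂ (transferFunction U p) (polydisc d) :=
  (DifferentiableOn.fun_sum fun t _ =>
    (differentiableOn_coord_mul (differentiableOn_systemState hU t) _).const_mul _).const_add _

theorem systemState_eq (hU : Uᴴ * U ≤ 1) {z : Fin d → ℂ} (hz : z ∈ polydisc d) (r : κ) :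
    systemState U p r z = U (some r) none +
      ∑ t, U (some r) (some t) * (z (p t) * systemState U p t z) := by
  have hinv : (1 - systemMatrix U p z) * systemResolvent U p z = 1 :=
    Matrix.mul_nonsing_inv _
      ((Matrix.isUnit_iff_isUnit_det _).mp (isUnit_one_sub_systemMatrix hU hz))
  have hstate : (1 - systemMatrix U p z) *ᵥ (fun r => systemState U p r z) =
      fun t => U (some t) none := by
    change _ *ᵥ (_ *ᵥ _) = _
    rw [Matrix.mulVec_mulVec, hinv, Matrix.one_mulVec]
  rw [← systemMatrix_mulVec_apply, ← congrFun hstate r, Matrix.sub_mulVec, Matrix.one_mulVec,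
    Pi.sub_apply, sub_add_cancel]

theorem systemResolvent_eq (hU : Uᴴ * U ≤ 1) {z : Fin d → ℂ} (hz : z ∈ polydisc d) (r u : κ) :
    systemResolvent U p z r u = (1 : Matrix κ κ ℂ) r u +
      ∑ t, U (some t) (some u) * (z (p u) * systemResolvent U p z r t) := by
  have hinv : systemResolvent U p z * (1 - systemMatrix U p z) = 1 :=
    Matrix.nonsing_inv_mul _
      ((Matrix.isUnit_iff_isUnit_det _).mp (isUnit_one_sub_systemMatrix hU hz))
  have hsum : ∑ t, U (some t) (some u) * (z (p u) * systemResolvent U p z r t) =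
      (systemResolvent U p z * systemMatrix U p z) r u := by
    rw [Matrix.mul_apply]
    exact Finset.sum_congr rfl fun t _ => by rw [systemMatrix_apply]; ring
  rw [hsum, ← hinv, Matrix.mul_sub, Matrix.mul_one, Matrix.sub_apply, sub_add_cancel]

theorem norm_transferFunction_le_one (hU : Uᴴ * U ≤ 1) {z : Fin d → ℂ} (hz : z ∈ polydisc d) :
    ‖transferFunction U p z‖ ≤ 1 := by
  have hcontr := norm_sq_add_sum_norm_sq_le hU 1 fun t => z (p t) * systemState U p t z
  simp only [smul_eq_mul, mul_one, norm_one, ← systemState_eq hU hz] at hcontr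
  rw [← transferFunction] at hcontr
  have hle : ∑ t, ‖z (p t) * systemState U p t z‖ ^ 2 ≤ ∑ t, ‖systemState U p t z‖ ^ 2 :=
    Finset.sum_le_sum fun t _ => norm_sq_coord_mul_le hz _ _
  exact (sq_le_one_iff₀ (norm_nonneg _)).mp (by linarith)

theorem supNorm_transferFunction_le_one (hU : Uᴴ * U ≤ 1) :
    supNorm (transferFunction U p) ≤ 1 := by
  refine iSup₂_le fun z hz => ?_
  rw [← ofReal_norm, ← ENNReal.ofReal_one]
  exact ENNReal.ofReal_le_ofReal (norm_transferFunction_le_one hU hz)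

end System

section SystemAtNode

open scoped MatrixOrder ComplexOrder

variable {d m : ℕ} {M : Fin d → Matrix (Fin m) (Fin m) ℂ} {κ : Type*} [Fintype κ]

theorem IsNode.matEval_const_mul_add_sum (hM : IsNode M) (c : ℂ) (u : κ → ℂ) (q : κ → Fin d)
    {f₀ : (Fin d → ℂ) → ℂ} (hf₀ : DifferentiableOn ℂ f₀ (polydisc d))
    {f : κ → (Fin d → ℂ) → ℂ} (hf : ∀ t, DifferentiableOn ℂ (f t) (polydisc d)) :
    matEval (fun z => c * f₀ z + ∑ t, u t * (z (q t) * f t z)) M =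
      c • matEval f₀ M + ∑ t, u t • (M (q t) * matEval (f t) M) := by
  have hterm : ∀ t, ContinuousOn (fun z => u t * (z (q t) * f t z)) (polydisc d) := fun t =>
    ((differentiableOn_coord_mul (hf t) (q t)).const_mul _).continuousOn
  rw [hM.matEval_add (hf₀.const_mul c).continuousOn (continuousOn_finsetSum _ fun t _ => hterm t),
    matEval_const_mul, hM.matEval_sum _ hterm]
  simp only [matEval_const_mul, hM.matEval_coord_mul (hf _)]

theorem IsNode.matEval_const_add_sum (hM : IsNode M) (c : ℂ) (u : κ → ℂ) (q : κ → Fin d)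
    {f : κ → (Fin d → ℂ) → ℂ} (hf : ∀ t, DifferentiableOn ℂ (f t) (polydisc d)) :
    matEval (fun z => c + ∑ t, u t * (z (q t) * f t z)) M =
      c • 1 + ∑ t, u t • (M (q t) * matEval (f t) M) := by
  simpa only [mul_one, hM.matEval_one] using
    hM.matEval_const_mul_add_sum c u q (differentiableOn_const 1) hf

variable [DecidableEq κ] {U : Matrix (Option κ) (Option κ) ℂ} {p : κ → Fin d}

theorem IsNode.matEval_systemResolvent (hM : IsNode M) (hU : Uᴴ * U ≤ 1) (r u : κ) :
    matEval (fun z => systemResolvent U p z r u) M =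
      (1 : Matrix κ κ ℂ) r u • (1 : Matrix (Fin m) (Fin m) ℂ) + ∑ t, U (some t) (some u) •
        (M (p u) * matEval (fun z => systemResolvent U p z r t) M) := by
  rw [← hM.matEval_const_add_sum _ _ _ fun t => differentiableOn_systemResolvent hU r t]
  exact hM.matEval_congr fun z hz => systemResolvent_eq hU hz r u

theorem IsNode.matEval_systemState (hM : IsNode M) (hU : Uᴴ * U ≤ 1) (r : κ) :
    matEval (systemState U p r) M = U (some r) none • 1 +
      ∑ t, U (some r) (some t) • (M (p t) * matEval (systemState U p t) M) := by
  rw [← hM.matEval_const_add_sum _ _ _ fun t => differentiableOn_systemState hU t]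
  exact hM.matEval_congr fun z hz => systemState_eq hU hz r

theorem IsNode.matEval_transferFunction (hM : IsNode M) (hU : Uᴴ * U ≤ 1) :
    matEval (transferFunction U p) M = U none none • 1 +
      ∑ t, U none (some t) • (M (p t) * matEval (systemState U p t) M) :=
  hM.matEval_const_add_sum _ _ _ fun t => differentiableOn_systemState hU t

theorem IsNode.eq_sum_matEval_systemResolvent_mul (hM : IsNode M) (hU : Uᴴ * U ≤ 1)
    {B Y : κ → Matrix (Fin m) (Fin m) ℂ}
    (hY : ∀ r, Y r = B r + ∑ t, U (some r) (some t) • (M (p t) * Y t)) (r : κ) :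
    Y r = ∑ t, matEval (fun z => systemResolvent U p z r t) M * B t := by
  let Q : κ → Matrix (Fin m) (Fin m) ℂ := fun t => matEval (fun z => systemResolvent U p z r t) M
  have hcomm : ∀ u t, Commute (M (p u)) (Q t) := fun u t =>
    hM.commute_matEval (differentiableOn_systemResolvent hU r t).continuousOn _
  have hQY : ∀ u, Q u * Y u = (1 : Matrix κ κ ℂ) r u • Y u +
      ∑ t, U (some t) (some u) • (Q t * (M (p u) * Y u)) := fun u => by
    calc Q u * Y u = ((1 : Matrix κ κ ℂ) r u • (1 : Matrix (Fin m) (Fin m) ℂ) +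
          ∑ t, U (some t) (some u) • (M (p u) * Q t)) * Y u :=
          congrArg (· * Y u) (hM.matEval_systemResolvent hU r u)
      _ = _ := by
          simp only [Matrix.add_mul, Matrix.smul_mul, Matrix.one_mul, Finset.sum_mul,
            (hcomm _ _).eq, Matrix.mul_assoc]
  have hsum : ∑ u, Q u * Y u = Y r + ∑ t, Q t * (Y t - B t) := by
    have hsub : ∀ t, Y t - B t = ∑ u, U (some t) (some u) • (M (p u) * Y u) := fun t =>
      sub_eq_of_eq_add' (hY t)
    simp only [hsub, hQY, Finset.sum_add_distrib, Finset.mul_sum, Matrix.mul_smul]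
    rw [Finset.sum_comm]
    simp [Matrix.one_apply]
  rw [Finset.sum_congr rfl fun t _ => mul_sub (Q t) (Y t) (B t), Finset.sum_sub_distrib,
    add_sub_left_comm] at hsum
  exact sub_eq_zero.mp (left_eq_add.mp hsum)

theorem IsNode.eq_of_system (hM : IsNode M) (hU : Uᴴ * U ≤ 1)
    {B Y Y' : κ → Matrix (Fin m) (Fin m) ℂ}
    (hY : ∀ r, Y r = B r + ∑ t, U (some r) (some t) • (M (p t) * Y t))
    (hY' : ∀ r, Y' r = B r + ∑ t, U (some r) (some t) • (M (p t) * Y' t)) (r : κ) : Y r = Y' r :=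
  (hM.eq_sum_matEval_systemResolvent_mul hU hY r).trans
    (hM.eq_sum_matEval_systemResolvent_mul hU hY' r).symm

theorem IsNode.matEval_systemState_mul (hM : IsNode M) (hU : Uᴴ * U ≤ 1)
    {f : (Fin d → ℂ) → ℂ} (hf : DifferentiableOn ℂ f (polydisc d)) (r : κ) :
    matEval (fun z => systemState U p r z * f z) M =
      matEval (systemState U p r) M * matEval f M := by
  refine hM.eq_of_system hU (p := p) (B := fun r => U (some r) none • matEval f M)
    (Y := fun r => matEval (fun z => systemState U p r z * f z) M)
    (Y' := fun r => matEval (systemState U p r) M * matEval f M) (fun r => ?_) (fun r => ?_) r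
  · rw [← hM.matEval_const_mul_add_sum _ _ _ hf
      fun t => (differentiableOn_systemState hU t).fun_mul hf]
    refine hM.matEval_congr fun z hz => ?_
    simp only [← mul_assoc, ← Finset.sum_mul, ← add_mul]
    simp only [mul_assoc, ← systemState_eq hU hz]
  · conv_lhs => rw [hM.matEval_systemState hU]
    simp only [Matrix.add_mul, Matrix.smul_mul, Matrix.one_mul, Finset.sum_mul, Matrix.mul_assoc]

theorem IsNode.matEval_transferFunction_mul (hM : IsNode M) (hU : Uᴴ * U ≤ 1)
    {f : (Fin d → ℂ) → ℂ} (hf : DifferentiableOn ℂ f (polydisc d)) :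
    matEval (fun z => transferFunction U p z * f z) M =
      matEval (transferFunction U p) M * matEval f M := by
  rw [hM.matEval_transferFunction hU]
  simp only [Matrix.add_mul, Matrix.smul_mul, Matrix.one_mul, Finset.sum_mul, Matrix.mul_assoc,
    ← hM.matEval_systemState_mul hU hf]
  rw [← hM.matEval_const_mul_add_sum _ _ _ hf
    fun t => (differentiableOn_systemState hU t).fun_mul hf]
  refine hM.matEval_congr fun z _ => ?_
  simp only [transferFunction, add_mul, Finset.sum_mul, mul_assoc]

end SystemAtNode

/-! ### Multipliers of admissible kernels -/

section Multiplier

open scoped MatrixOrder ComplexOrder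

variable {d : ℕ} (k : AdmissibleKernel d)

theorem AdmissibleKernel.inner_pointKernel (z : polydisc d) (f : k.H) :
    inner ℂ (k.pointKernel z) f = f z := by
  rw [pointKernel, RKHS.kerFun_inner]
  simp

/-- The linear combination of the vectors `w z • k_z` with the given coefficients. -/
def AdmissibleKernel.weightedKernel (w : polydisc d → ℂ) : (polydisc d →₀ ℂ) →ₗ[ℂ] k.H :=
  Finsupp.linearCombination ℂ fun z => w z • k.pointKernel z

theorem AdmissibleKernel.weightedKernel_single (w : polydisc d → ℂ) (z : polydisc d) :
    k.weightedKernel w (Finsupp.single z 1) = w z • k.pointKernel z := by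
  simp [weightedKernel]

theorem AdmissibleKernel.inner_weightedKernel (w : polydisc d → ℂ) (c : polydisc d →₀ ℂ)
    (f : k.H) :
    inner ℂ (k.weightedKernel w c) f = c.sum fun z a => conj a * (conj (w z) * f z) := by
  simp only [weightedKernel, Finsupp.linearCombination_apply, Finsupp.sum, sum_inner,
    inner_smul_left, k.inner_pointKernel]

theorem AdmissibleKernel.norm_weightedKernel_coord_le (i : Fin d) (w : polydisc d → ℂ)
    (c : polydisc d →₀ ℂ) :
    ‖k.weightedKernel (fun z => conj (z.1 i) * w z) c‖ ≤ ‖k.weightedKernel w c‖ := by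
  set x := k.weightedKernel (fun z => conj (z.1 i) * w z) c with hx
  obtain ⟨g, hg, hgx⟩ := k.contraction i x
  have hadjoint : inner ℂ x x = inner ℂ (k.weightedKernel w c) g := by
    conv_lhs => rw [hx]
    rw [k.inner_weightedKernel, k.inner_weightedKernel]
    refine Finsupp.sum_congr fun z _ => ?_
    rw [hg, map_mul, Complex.conj_conj]
    ring
  have hsq : ‖x‖ * ‖x‖ ≤ ‖k.weightedKernel w c‖ * ‖x‖ :=
    calc ‖x‖ * ‖x‖ = RCLike.re (inner ℂ (k.weightedKernel w c) g) := by
          rw [← inner_self_eq_norm_mul_norm (𝕜 := ℂ), hadjoint]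
      _ ≤ ‖k.weightedKernel w c‖ * ‖g‖ := (RCLike.re_le_norm _).trans (norm_inner_le_norm _ _)
      _ ≤ ‖k.weightedKernel w c‖ * ‖x‖ := mul_le_mul_of_nonneg_left hgx (norm_nonneg _)
  rcases (norm_nonneg x).eq_or_lt with hzero | hpos
  · exact hzero.symm.trans_le (norm_nonneg _)
  · exact le_of_mul_le_mul_right hsq hpos

theorem AdmissibleKernel.weightedKernel_const_add_sum {κ : Type*} [Fintype κ] (a : ℂ) (u : κ → ℂ)
    (w : κ → polydisc d → ℂ) (c : polydisc d →₀ ℂ) :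
    k.weightedKernel (fun z => a + ∑ t, u t * w t z) c =
      a • k.weightedKernel (fun _ => 1) c + ∑ t, u t • k.weightedKernel (w t) c := by
  simp only [weightedKernel, Finsupp.linearCombination_apply, Finsupp.sum, Finset.smul_sum,
    one_smul]
  rw [Finset.sum_comm, ← Finset.sum_add_distrib]
  refine Finset.sum_congr rfl fun z _ => ?_
  simp only [add_smul, smul_add, Finset.sum_smul, Finset.smul_sum, mul_smul,
    smul_comm (c z)]

variable {κ : Type*} [Fintype κ] [DecidableEq κ] {U : Matrix (Option κ) (Option κ) ℂ}
  {p : κ → Fin d}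

theorem AdmissibleKernel.norm_weightedKernel_transferFunction_le (hU : Uᴴ * U ≤ 1)
    (c : polydisc d →₀ ℂ) :
    ‖k.weightedKernel (fun z => conj (transferFunction U p z)) c‖ ≤
      ‖k.weightedKernel (fun _ => 1) c‖ := by
  let x : κ → k.H := fun t =>
    k.weightedKernel (fun z => conj (z.1 (p t)) * conj (systemState U p t z)) c
  have hout : k.weightedKernel (fun z => conj (transferFunction U p z)) c =
      conj (U none none) • k.weightedKernel (fun _ => 1) c +
        ∑ t, conj (U none (some t)) • x t := by
    rw [← k.weightedKernel_const_add_sum]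
    simp only [transferFunction, map_add, map_sum, map_mul]
  have hstate : ∀ r, k.weightedKernel (fun z => conj (systemState U p r z)) c =
      conj (U (some r) none) • k.weightedKernel (fun _ => 1) c +
        ∑ t, conj (U (some r) (some t)) • x t := fun r => by
    rw [← k.weightedKernel_const_add_sum]
    refine congrArg (k.weightedKernel · c) (funext fun z => ?_)
    simpa only [map_add, map_sum, map_mul] using congrArg conj (systemState_eq hU z.2 r)
  have hcontr := norm_sq_add_sum_norm_sq_le (conjTranspose_mul_self_map_conj_le_one hU)
    (k.weightedKernel (fun _ => 1) c) x
  simp only [Matrix.map_apply, ← hout, ← hstate] at hcontr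
  have hx : ∑ t, ‖x t‖ ^ 2 ≤
      ∑ t, ‖k.weightedKernel (fun z => conj (systemState U p t z)) c‖ ^ 2 :=
    Finset.sum_le_sum fun t _ =>
      pow_le_pow_left₀ (norm_nonneg _) (k.norm_weightedKernel_coord_le _ _ c) 2
  exact le_of_sq_le_sq (by linarith) (norm_nonneg _)

/-- The adjoint of multiplication by `ψ` is determined by `k_z ↦ conj (ψ z) • k_z`. -/
theorem AdmissibleKernel.exists_mul_of_norm_weightedKernel_le {ψ : polydisc d → ℂ}
    (h : ∀ c, ‖k.weightedKernel (fun z => conj (ψ z)) c‖ ≤ ‖k.weightedKernel (fun _ => 1) c‖) :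
    ∃ T : k.H →L[ℂ] k.H, ‖T‖ ≤ 1 ∧ ∀ f z, T f z = ψ z * f z := by
  obtain ⟨L, hL, hLk⟩ := exists_continuousLinearMap_apply_eq_of_norm_le _ _ h
  refine ⟨ContinuousLinearMap.adjoint L, (ContinuousLinearMap.adjoint.norm_map L).trans_le hL,
    fun f z => ?_⟩
  have hLz : L (k.pointKernel z) = conj (ψ z) • k.pointKernel z := by
    simpa only [k.weightedKernel_single, one_smul] using hLk (Finsupp.single z 1)
  rw [← k.inner_pointKernel, ContinuousLinearMap.adjoint_inner_right, hLz, inner_smul_left,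
    Complex.conj_conj, k.inner_pointKernel]

theorem AdmissibleKernel.exists_mul_transferFunction (p : κ → Fin d) (hU : Uᴴ * U ≤ 1) :
    ∃ T : k.H →L[ℂ] k.H, ‖T‖ ≤ 1 ∧ ∀ f z, T f z = transferFunction U p z * f z :=
  k.exists_mul_of_norm_weightedKernel_le (k.norm_weightedKernel_transferFunction_le hU)

end Multiplier

/-! ### Interpolation -/

section Norms

variable {d N : ℕ} {s : Fin N → ℕ} {A : ∀ j, Fin d → Matrix (Fin (s j)) (Fin (s j)) ℂ}
  {hA : ∀ j, IsNode (A j)} {φ : Fin N → (Fin d → ℂ) → ℂ}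

theorem AdmissibleKernel.IsRExt.exists_isR {k : AdmissibleKernel d} {z : polydisc d} {w : ℂ}
    {R : k.nodeSpaceExt hA z →L[ℂ] k.nodeSpaceExt hA z} (hR : k.IsRExt hA φ z w R) :
    ∃ R₀, k.IsR hA φ R₀ ∧ ‖R₀‖ ≤ ‖R‖ := by
  let ι : k.nodeSpace hA →ₗᵢ[ℂ] k.nodeSpaceExt hA z :=
    ⟨Submodule.inclusion le_sup_left, fun _ => rfl⟩
  let T : k.nodeSpace hA →L[ℂ] k.H :=
    (k.nodeSpaceExt hA z).subtypeL.comp (R.comp ι.toContinuousLinearMap)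
  have hTker : ∀ j u v, T ⟨_, k.nodeKernel_mem hA j u v⟩ =
      k.nodeKernel (hA j) u ((matEval (φ j) (A j))ᴴ *ᵥ v) := fun j u v =>
    congrArg Subtype.val (hR.1 j u v)
  have hT : ∀ x, T x ∈ k.nodeSpace hA := fun x => by
    refine Submodule.span_induction (p := fun y hy => T ⟨y, hy⟩ ∈ k.nodeSpace hA) ?_ ?_ ?_ ?_ x.2
    · rintro _ ⟨j, u, v, rfl⟩
      exact (hTker j u v).symm ▸ k.nodeKernel_mem hA j _ _
    · exact (map_zero T).symm ▸ zero_mem _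
    · exact fun x y hx hy hTx hTy => (map_add T ⟨x, hx⟩ ⟨y, hy⟩).symm ▸ add_mem hTx hTy
    · exact fun c x hx hTx => (map_smul T c ⟨x, hx⟩).symm ▸ Submodule.smul_mem _ c hTx
  refine ⟨T.codRestrict _ hT, fun j u v => Subtype.ext (hTker j u v), ?_⟩
  exact ContinuousLinearMap.opNorm_le_bound _ R.opNorm_nonneg fun x => R.le_opNorm (ι x)

theorem AdmissibleKernel.normR_le_normRExt (k : AdmissibleKernel d) (z : polydisc d) (w : ℂ) :
    k.normR hA φ ≤ k.normRExt hA φ z w := by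
  refine le_iInf₂ fun R hR => ?_
  obtain ⟨R₀, hR₀, hle⟩ := hR.exists_isR
  refine (iInf₂_le R₀ hR₀).trans ?_
  rw [← ofReal_norm, ← ofReal_norm]
  exact ENNReal.ofReal_le_ofReal hle

/-- The restriction of the adjoint of `T` is the extension of `R`. -/
theorem AdmissibleKernel.exists_isRExt {k : AdmissibleKernel d} {z : polydisc d} {w : ℂ}
    (T : k.H →L[ℂ] k.H) (hTz : ∀ f, T f z = w * f z)
    (hTA : ∀ f j, matEval (extendZero (T f)) (A j) =
      matEval (φ j) (A j) * matEval (extendZero f) (A j)) :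
    ∃ R, k.IsRExt hA φ z w R ∧ ‖R‖ ≤ ‖T‖ := by
  let L := ContinuousLinearMap.adjoint T
  have hLnode : ∀ j u v, L (k.nodeKernel (hA j) u v) =
      k.nodeKernel (hA j) u ((matEval (φ j) (A j))ᴴ *ᵥ v) := fun j u v => by
    refine ext_inner_right ℂ fun f => ?_
    rw [ContinuousLinearMap.adjoint_inner_left, k.inner_nodeKernel, k.inner_nodeKernel, hTA,
      Matrix.star_mulVec, Matrix.conjTranspose_conjTranspose, ← Matrix.dotProduct_mulVec,
      Matrix.mulVec_mulVec]
  have hLpoint : L (k.pointKernel z) = conj w • k.pointKernel z := by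
    refine ext_inner_right ℂ fun f => ?_
    rw [ContinuousLinearMap.adjoint_inner_left, inner_smul_left, k.inner_pointKernel,
      k.inner_pointKernel, hTz, Complex.conj_conj]
  have hinv : k.nodeSpaceExt hA z ≤ (k.nodeSpaceExt hA z).comap L.toLinearMap := by
    refine sup_le (Submodule.span_le.mpr ?_) (Submodule.span_le.mpr ?_)
    · rintro _ ⟨j, u, v, rfl⟩
      change L _ ∈ k.nodeSpaceExt hA z
      exact hLnode j u v ▸ k.nodeKernel_mem_ext hA z j _ _
    · rintro _ rfl
      change L _ ∈ k.nodeSpaceExt hA z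
      exact hLpoint ▸ Submodule.smul_mem _ _ (k.pointKernel_mem_ext hA z)
  refine ⟨(L.comp (k.nodeSpaceExt hA z).subtypeL).codRestrict _ fun x => hinv x.2,
    ⟨fun j u v => Subtype.ext (hLnode j u v), Subtype.ext hLpoint⟩, ?_⟩
  refine ContinuousLinearMap.opNorm_le_bound _ (norm_nonneg _) fun x => ?_
  exact L.le_of_opNorm_le (ContinuousLinearMap.adjoint.norm_map T).le x.1

end Norms

section Interpolation

open scoped MatrixOrder ComplexOrder

variable {d N : ℕ} {s : Fin N → ℕ} {A : ∀ j, Fin d → Matrix (Fin (s j)) (Fin (s j)) ℂ}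
  {φ : Fin N → (Fin d → ℂ) → ℂ}

theorem exists_interpolating_transferFunction (hA : ∀ j, IsNode (A j)) {C : ℝ} (hC : 0 ≤ C)
    (h : ∀ k : AdmissibleKernel d, k.normR hA φ ≤ ENNReal.ofReal C) :
    ∃ (κ : Type) (_ : Fintype κ) (_ : DecidableEq κ) (p : κ → Fin d)
      (U : Matrix (Option κ) (Option κ) ℂ), Uᴴ * U ≤ 1 ∧
      ∀ j, matEval (φ j) (A j) = (C : ℂ) • matEval (transferFunction U p) (A j) := by
  obtain ⟨κ, hκ, hκ', p, U, g, hU, hφ, hg⟩ := exists_node_realization hC h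
  refine ⟨κ, hκ, hκ', p, U, hU, fun j => ?_⟩
  have hstate : ∀ r, g r j = (C : ℂ) • matEval (systemState U p r) (A j) := by
    refine (hA j).eq_of_system hU (p := p) (fun r => hg r j) fun r => ?_
    conv_lhs => rw [(hA j).matEval_systemState hU]
    simp only [smul_add, Finset.smul_sum, Matrix.mul_smul, smul_smul, mul_comm (C : ℂ)]
  rw [hφ, (hA j).matEval_transferFunction hU]
  simp only [hstate, smul_add, Finset.smul_sum, Matrix.mul_smul, smul_smul, mul_comm (C : ℂ)]

theorem AdmissibleKernel.normRExt_le_of_transferFunction (k : AdmissibleKernel d)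
    {hA : ∀ j, IsNode (A j)} {C : ℝ} (hC : 0 ≤ C) {κ : Type*} [Fintype κ] [DecidableEq κ]
    {p : κ → Fin d} {U : Matrix (Option κ) (Option κ) ℂ} (hU : Uᴴ * U ≤ 1)
    (hφ : ∀ j, matEval (φ j) (A j) = (C : ℂ) • matEval (transferFunction U p) (A j))
    (z : polydisc d) :
    k.normRExt hA φ z (C * transferFunction U p z) ≤ ENNReal.ofReal C := by
  obtain ⟨T, hT, hTmul⟩ := k.exists_mul_transferFunction p hU
  have hCT : ∀ f y, ((C : ℂ) • T) f y = C * (transferFunction U p y * f y) := fun f y => by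
    rw [smul_apply, RKHS.coe_smul, Pi.smul_apply, hTmul, smul_eq_mul]
  have hCTA : ∀ f j, matEval (extendZero (((C : ℂ) • T) f)) (A j) =
      matEval (φ j) (A j) * matEval (extendZero f) (A j) := fun f j => by
    rw [hφ, Matrix.smul_mul, ← (hA j).matEval_transferFunction_mul hU (k.holomorphic f),
      ← matEval_const_mul]
    refine (hA j).matEval_congr (extendZero_eqOn fun y => ?_)
    rw [hCT, extendZero_apply]
  obtain ⟨R, hR, hRT⟩ := AdmissibleKernel.exists_isRExt (hA := hA) (z := z) ((C : ℂ) • T)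
    (fun f => (hCT f z).trans (mul_assoc _ _ _).symm) hCTA
  refine (iInf₂_le R hR).trans ?_
  rw [← ofReal_norm]
  refine ENNReal.ofReal_le_ofReal (hRT.trans ?_)
  rw [norm_smul, Complex.norm_real, Real.norm_of_nonneg hC]
  exact mul_le_of_le_one_right hC hT

theorem exists_memHInfty_matEval_eq {hA : ∀ j, IsNode (A j)}
    (h : (⨆ k : AdmissibleKernel d, k.normR hA φ) ≤ 1) :
    ∃ ψ : (Fin d → ℂ) → ℂ, MemHInfty ψ ∧ supNorm ψ ≤ 1 ∧
      ∀ j, matEval ψ (A j) = matEval (φ j) (A j) := by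
  obtain ⟨κ, _, _, p, U, hU, hφ⟩ := exists_interpolating_transferFunction hA zero_le_one fun k =>
    (iSup_le_iff.mp h k).trans ENNReal.ofReal_one.ge
  have hsup : supNorm (transferFunction U p) ≤ 1 := supNorm_transferFunction_le_one hU
  refine ⟨transferFunction U p, ⟨differentiableOn_transferFunction hU,
    hsup.trans_lt ENNReal.one_lt_top⟩, hsup, fun j => ?_⟩
  rw [hφ, Complex.ofReal_one, one_smul]

theorem exists_iSup_normRExt_eq (hA : ∀ j, IsNode (A j)) (φ : Fin N → (Fin d → ℂ) → ℂ)
    (z : polydisc d) : ∃ w : ℂ, (⨆ k : AdmissibleKernel d, k.normRExt hA φ z w) =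
      ⨆ k : AdmissibleKernel d, k.normR hA φ := by
  suffices hle : ∃ w : ℂ, ∀ k : AdmissibleKernel d,
      k.normRExt hA φ z w ≤ ⨆ k : AdmissibleKernel d, k.normR hA φ by
    obtain ⟨w, hw⟩ := hle
    exact ⟨w, le_antisymm (iSup_le hw) (iSup_mono fun k => k.normR_le_normRExt z w)⟩
  by_cases htop : (⨆ k : AdmissibleKernel d, k.normR hA φ) = ∞
  · exact ⟨0, fun k => htop ▸ le_top⟩
  · obtain ⟨C, hC, hCeq⟩ : ∃ C : ℝ, 0 ≤ C ∧
        ENNReal.ofReal C = ⨆ k : AdmissibleKernel d, k.normR hA φ :=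
      ⟨_, ENNReal.toReal_nonneg, ENNReal.ofReal_toReal htop⟩
    obtain ⟨κ, _, _, p, U, hU, hφ⟩ := exists_interpolating_transferFunction hA hC
      (iSup_le_iff.mp hCeq.ge)
    exact ⟨_, fun k => hCeq ▸ k.normRExt_le_of_transferFunction hC hU hφ z⟩

end Interpolation

end

theorem theorem2p1_general {d N : ℕ} {s : Fin N → ℕ}
    {A : ∀ j, Fin d → Matrix (Fin (s j)) (Fin (s j)) ℂ} (hA : ∀ j, IsNode (A j))
    (φ : Fin N → (Fin d → ℂ) → ℂ) :
    ((⨆ k : AdmissibleKernel d, k.normR hA φ) ≤ 1 →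
      ∃ ψ : (Fin d → ℂ) → ℂ, MemHInfty ψ ∧ supNorm ψ ≤ 1 ∧
        ∀ j, matEval ψ (A j) = matEval (φ j) (A j)) ∧
    ∀ z : polydisc d, ∃ w : ℂ,
      (⨆ k : AdmissibleKernel d, k.normRExt hA φ z w) =
        ⨆ k : AdmissibleKernel d, k.normR hA φ :=
  ⟨exists_memHInfty_matEval_eq, exists_iSup_normRExt_eq hA φ⟩

theorem theorem2p1 :
    (∀ (N : ℕ) (s : Fin N → ℕ) (A : ∀ j, Fin 2 → Matrix (Fin (s j)) (Fin (s j)) ℂ)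
        (hA : ∀ j, IsNode (A j)) (φ : Fin N → (Fin 2 → ℂ) → ℂ),
        (∀ j, MemHInfty (φ j)) →
        (⨆ k : AdmissibleKernel 2, k.normR hA φ) ≤ 1 →
        ∃ ψ : (Fin 2 → ℂ) → ℂ, MemHInfty ψ ∧ supNorm ψ ≤ 1 ∧
          ∀ j, matEval ψ (A j) = matEval (φ j) (A j)) ∧
    (∀ (d : ℕ), 1 ≤ d →
      ∀ (N : ℕ) (s : Fin N → ℕ) (A : ∀ j, Fin d → Matrix (Fin (s j)) (Fin (s j)) ℂ)
        (hA : ∀ j, IsNode (A j)) (φ : Fin N → (Fin d → ℂ) → ℂ),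
        (∀ j, MemHInfty (φ j)) →
        ∀ z : polydisc d, ∃ w : ℂ,
          (⨆ k : AdmissibleKernel d, k.normRExt hA φ z w) =
            ⨆ k : AdmissibleKernel d, k.normR hA φ) :=
  ⟨fun _ _ _ hA φ _ => (theorem2p1_general hA φ).1,
    fun _ _ _ _ _ hA φ _ => (theorem2p1_general hA φ).2⟩
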